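/- Let $\alpha\in\{4,8\}$ and let $\beta$ be the other element of $\{4,8\}$. On $\mathbb{R}^2$ let $d_4(x,y)=|x_1-y_1|+|x_2-y_2|$ and $d_8(x,y)=\max\{|x_1-y_1|,|x_2-y_2|\}$, and for $S\subseteq\mathbb{Z}^2$ put $d_\alpha(x,S)=\inf_{z\in S}d_\alpha(x,z)$. Two points of $\mathbb{Z}^2$ are $d_\alpha$-adjacent if their $d_\alpha$-distance is $1$. Let $T\subset\mathbb{Z}^2$ be an $\alpha$-connected component, that is, a finite nonempty set any two points of which are joined by a sequence of points of $T$ in which consecutive points are $d_\alpha$-adjacent. Let $P_\alpha(T)$ be the set of points of $\mathbb{Z}^2\setminus T$ that are $d_\alpha$-adjacent to a point of $T$. Let $G_\alpha(T)$ be the graph with vertex set $\mathbb{Z}^2$ whose edges join any two $d_\alpha$-adjacent points of $\mathbb{Z}^2\setminus P_\alpha(T)$ and any two $d_\beta$-adjacent points of $P_\alpha(T)$. Let $E_\alpha(T)$ be the unique infinite connected component of $G_\alpha(T)$, and let $P_\alpha^{ext}(T)$ be the subgraph of $G_\alpha(T)$ induced by the points of $P_\alpha(T)$ that are $d_\alpha$-adjacent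 to a point of $E_\alpha(T)$. Embed $P_\alpha^{ext}(T)$ in $\mathbb{R}^2$ by drawing its edges as straight segments (this gives a simple closed polygon). Let $V_\alpha(T)\subset\mathbb{R}^2$ be the open polygonal region bounded by this polygon, that is, the set of the points off the polygon that lie in a bounded connected component of its complement, and let $Z_\alpha(T)=V_\alpha(T)\cap\mathbb{Z}^2$. Then $$V_\alpha(T)=\{x\in\mathbb{R}^2 : d_\alpha(x,Z_\alpha(T))<d_\alpha(x,E_\alpha(T))\}.$$ -/

import Mathlib

namespace DigitalImage

/-- The two notions of connectivity of digital images: `α = 4` and `α = 8`. -/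
inductive Connectivity where
  | four
  | eight

/-- The dual `β` of `α`: `(α, β) = (4, 8)` or `(α, β) = (8, 4)`. -/
def Connectivity.dual : Connectivity → Connectivity
  | .four => .eight
  | .eight => .four

/-- Pixels are the points of `ℤ²`. -/
abbrev Pixel := ℤ × ℤ

/-- The inclusion `ℤ² ⊆ ℝ²`. -/
def toPlane (p : Pixel) : ℝ × ℝ := ((p.1 : ℝ), (p.2 : ℝ))

/-- The metric `d_α` on `ℝ²`: `d₄` is the `ℓ¹` metric, `d₈` is the `ℓ^∞` metric. -/
def gridDist : Connectivity → ℝ × ℝ → ℝ × ℝ → ℝ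
  | .four, x, y => |x.1 - y.1| + |x.2 - y.2|
  | .eight, x, y => max |x.1 - y.1| |x.2 - y.2|

/-- The distance `d_α(x, S)` from a point `x` of the plane to a set `S` of pixels, as an infimum
in `[0, ∞]` (so that the distance to the empty set is `∞`). -/
noncomputable def distTo (α : Connectivity) (x : ℝ × ℝ) (S : Set Pixel) : ENNReal :=
  ⨅ z ∈ S, ENNReal.ofReal (gridDist α x (toPlane z))

/-- Two pixels are `d_α`-adjacent if their `d_α`-distance is `1`. -/
def PixelAdj (α : Connectivity) (x y : Pixel) : Prop :=
  gridDist α (toPlane x) (toPlane y) = 1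

theorem PixelAdj.symm {α : Connectivity} {x y : Pixel} (h : PixelAdj α x y) :
    PixelAdj α y x := by
  cases α <;> simpa only [PixelAdj, gridDist, abs_sub_comm] using h

theorem not_pixelAdj_self (α : Connectivity) (x : Pixel) : ¬ PixelAdj α x x := by
  cases α <;> simp [PixelAdj, gridDist]

/-- The graph on `ℤ²` given by `d_α`-adjacency. -/
def pixelGraph (α : Connectivity) : SimpleGraph Pixel where
  Adj := PixelAdj α
  symm := ⟨fun _ _ h => h.symm⟩
  loopless := ⟨fun x h => not_pixelAdj_self α x h⟩

/-- `T` is an `α`-connected component: a finite nonempty set of pixels any two of which are joined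
by a sequence of `d_α`-adjacent pixels inside `T`. (Such a `T` is a connected component of the image
in which exactly the pixels of `T` are white, and every finite component of an image is such a set;
`SimpleGraph.Connected` includes non-emptiness.) -/
def IsComponent (α : Connectivity) (T : Set Pixel) : Prop :=
  T.Finite ∧ ((pixelGraph α).induce T).Connected

/-- The two colors of a binary image. -/
inductive Color where
  | black
  | white

/-- Binary images with domain `ℤ²`. -/
abbrev Image := Pixel → Color

/-- The graph `I_α` of an image `I`: edges join white pixels that are `d_α`-adjacent and black
pixels that are `d_β`-adjacent. -/
def Image.graph (I : Image) (α : Connectivity) : SimpleGraph Pixel where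
  Adj x y := (I x = .white ∧ I y = .white ∧ PixelAdj α x y) ∨
    (I x = .black ∧ I y = .black ∧ PixelAdj α.dual x y)
  symm := ⟨fun _ _ h => h.imp (fun h => ⟨h.2.1, h.1, h.2.2.symm⟩)
    (fun h => ⟨h.2.1, h.1, h.2.2.symm⟩)⟩
  loopless := ⟨fun x h => h.elim (fun h => not_pixelAdj_self _ x h.2.2)
    (fun h => not_pixelAdj_self _ x h.2.2)⟩

/-- The site perimeter `P_α(T)`: the pixels outside `T` that are `d_α`-adjacent to `T`. -/
def sitePerimeter (α : Connectivity) (T : Set Pixel) : Set Pixel :=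
  {z | z ∉ T ∧ ∃ t ∈ T, PixelAdj α z t}

open Classical in
/-- The image that is black exactly on the set `P`. -/
noncomputable def blackImage (P : Set Pixel) : Image :=
  fun z => if z ∈ P then .black else .white

/-- The characteristic graph `G_α(T)` of the site perimeter of `T`. -/
noncomputable def charGraph (α : Connectivity) (T : Set Pixel) : SimpleGraph Pixel :=
  (blackImage (sitePerimeter α T)).graph α

/-- `E_α(T)`: the infinite connected component of `G_α(T)`, as the set of the pixels whose connected
component in `G_α(T)` is infinite. (`P_α(T)` is finite, so there is exactly one such component.) -/
def exterior (α : Connectivity) (T : Set Pixel) : Set Pixel :=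
  {z | ((charGraph α T).connectedComponentMk z).supp.Infinite}

/-- The vertex set of the exterior site perimeter `P_α^ext(T)`: the pixels of `P_α(T)` that are
`d_α`-adjacent to a pixel of `E_α(T)`. -/
def extPerimeter (α : Connectivity) (T : Set Pixel) : Set Pixel :=
  {z | z ∈ sitePerimeter α T ∧ ∃ e ∈ exterior α T, PixelAdj α z e}

/-- The embedding in `ℝ²` of the graph `P_α^ext(T)`, that is, of the subgraph of `G_α(T)` induced by
its vertex set: the union of the straight segments that join the end points of its edges. -/
def extPolygon (α : Connectivity) (T : Set Pixel) : Set (ℝ × ℝ) :=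
  {x | ∃ u ∈ extPerimeter α T, ∃ v ∈ extPerimeter α T,
    (charGraph α T).Adj u v ∧ x ∈ segment ℝ (toPlane u) (toPlane v)}

/-- `V_α(T)`: the open polygonal region bounded by the polygon `P_α^ext(T)`, that is, its inside:
the points off the polygon whose connected component in the complement of the polygon is bounded. -/
def region (α : Connectivity) (T : Set Pixel) : Set (ℝ × ℝ) :=
  {x | x ∉ extPolygon α T ∧
    Bornology.IsBounded (connectedComponentIn (extPolygon α T)ᶜ x)}

/-- `Z_α(T) = V_α(T) ∩ ℤ²`. -/
def interiorPixels (α : Connectivity) (T : Set Pixel) : Set Pixel :=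
  {z | toPlane z ∈ region α T}

end DigitalImage

/-! ### Adjacency in integer coordinates -/

namespace DigitalImage

/-! Let E be the exterior, Q the exterior perimeter and N the set of the remaining pixels. The heart
of the proof is that the polygon is exactly the set of the points of the plane that are strictly
closer to neither of E and N (`polygon_eq_equidistant`). Its complement is therefore the disjoint
union of two open sets, the points closer to N and the points closer to E. The second is path
connected and unbounded because E is α-connected and infinite; the first is bounded because E has
finite complement. So the region is the set of points closer to N (`region_eq_closer`), and its
pixels are those of N (`toPlane_mem_closer_iff`), which is the claim. Neither the Jordan curve
theorem nor the simplicity of the polygon is needed.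

That the polygon is the equidistant set rests on the local picture at Q: an edge of the polygon has
E on one side and N on the other (`four_edge`, `four_diag`, `eight_edge`), and for α = 8 no cell has
all four corners in Q (`eight_cell`). Distances to E and N from a point of an edge can then be
computed and agree. Conversely, a point at distance less than 1 from a pixel of E or N is strictly
closer to that set, which leaves only the edges.

The local picture comes from a discrete, mod 2 Jordan argument. Two adjacent points of Q are joined
by a path through E and the path is closed by the edge between them. The parity of crossings with a
vertical ray changes across that edge, yet it is constant on the rest of the complement of E, since
that set stays connected when two points of Q are deleted (`parity_eq`). This connectedness follows
from that of T (`separation`). -/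

theorem pixelAdj_four_iff {x y : Pixel} : PixelAdj .four x y ↔
    (x.1 = y.1 ∧ (x.2 = y.2 + 1 ∨ y.2 = x.2 + 1)) ∨
      (x.2 = y.2 ∧ (x.1 = y.1 + 1 ∨ y.1 = x.1 + 1)) := by
  have h : PixelAdj .four x y ↔ |x.1 - y.1| + |x.2 - y.2| = 1 := by
    simp only [PixelAdj, gridDist, toPlane]
    exact_mod_cast Iff.rfl
  rw [h]
  rcases abs_cases (x.1 - y.1) with h1 | h1 <;> rcases abs_cases (x.2 - y.2) with h2 | h2 <;> omega

theorem pixelAdj_eight_iff {x y : Pixel} : PixelAdj .eight x y ↔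
    (x.1 ≠ y.1 ∨ x.2 ≠ y.2) ∧ x.1 ≤ y.1 + 1 ∧ y.1 ≤ x.1 + 1 ∧ x.2 ≤ y.2 + 1 ∧ y.2 ≤ x.2 + 1 := by
  have h : PixelAdj .eight x y ↔ max |x.1 - y.1| |x.2 - y.2| = 1 := by
    simp only [PixelAdj, gridDist, toPlane]
    exact_mod_cast Iff.rfl
  rw [h]
  rcases abs_cases (x.1 - y.1) with h1 | h1 <;> rcases abs_cases (x.2 - y.2) with h2 | h2 <;>
    rcases max_cases |x.1 - y.1| |x.2 - y.2| with h3 | h3 <;> omega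

theorem PixelAdj.of_four {α : Connectivity} {x y : Pixel} (h : PixelAdj .four x y) :
    PixelAdj α x y := by
  cases α
  · exact h
  · rw [pixelAdj_four_iff] at h
    rw [pixelAdj_eight_iff]
    omega

theorem PixelAdj.eight {α : Connectivity} {x y : Pixel} (h : PixelAdj α x y) :
    PixelAdj .eight x y := by
  cases α
  · exact h.of_four
  · exact h

theorem PixelAdj.ne {α : Connectivity} {x y : Pixel} (h : PixelAdj α x y) : x ≠ y := by
  rintro rfl
  exact not_pixelAdj_self α x h

/-! ### Mod 2 cycles of pixels and crossing parities -/

/-- The sum of `g` over the steps of a list. -/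
def stepSum (L : List (Pixel × Pixel)) (g : Pixel → Pixel → ZMod 2) : ZMod 2 :=
  (L.map fun s => g s.1 s.2).sum

theorem stepSum_append (L M : List (Pixel × Pixel)) (g : Pixel → Pixel → ZMod 2) :
    stepSum (L ++ M) g = stepSum L g + stepSum M g := by
  simp [stepSum]

theorem stepSum_add (L : List (Pixel × Pixel)) (g h : Pixel → Pixel → ZMod 2) :
    stepSum L (fun a b => g a b + h a b) = stepSum L g + stepSum L h := by
  simp [stepSum, List.sum_map_add]

theorem stepSum_congr {L : List (Pixel × Pixel)} {g h : Pixel → Pixel → ZMod 2}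
    (H : ∀ s ∈ L, g s.1 s.2 = h s.1 s.2) : stepSum L g = stepSum L h := by
  unfold stepSum
  rw [List.map_congr_left H]

/-- A list of steps is a mod 2 cycle of `8`-adjacent pixels if its boundary vanishes. -/
structure IsCycle (L : List (Pixel × Pixel)) : Prop where
  adj : ∀ s ∈ L, PixelAdj .eight s.1 s.2
  boundary : ∀ f : Pixel → ZMod 2, stepSum L (fun a b => f a + f b) = 0

/-- The indicator of the event that a step joins `p` and `q`. -/
def joins (p q a b : Pixel) : ZMod 2 :=
  if (a = p ∧ b = q) ∨ (a = q ∧ b = p) then 1 else 0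

/-- The indicator of the event that a step crosses the upward ray that starts slightly to the
right of `p`. -/
def crosses (p a b : Pixel) : ZMod 2 :=
  if (a.1 = p.1 ∧ b.1 = p.1 + 1 ∧ p.2 < a.2) ∨ (b.1 = p.1 ∧ a.1 = p.1 + 1 ∧ p.2 < b.2) then 1 else 0

/-- The multiplicity mod 2 of the step `pq`. -/
def mult (L : List (Pixel × Pixel)) (p q : Pixel) : ZMod 2 := stepSum L (joins p q)

/-- The parity of the number of crossings with the ray of `p`. -/
def parity (L : List (Pixel × Pixel)) (p : Pixel) : ZMod 2 := stepSum L (crosses p)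

theorem joins_symm (p q a b : Pixel) : joins p q a b = joins p q b a := by
  simp only [joins, or_comm, and_comm]

theorem crosses_symm (p a b : Pixel) : crosses p a b = crosses p b a := by
  simp only [crosses, or_comm]

theorem crosses_of_lt {p a b : Pixel} (h : b.1 = a.1 + 1) :
    crosses p a b = if a.1 = p.1 ∧ p.2 < a.2 then 1 else 0 := by
  unfold crosses
  congr 1
  simp only [eq_iff_iff]
  omega

theorem joins_of_lt {x y z w a b c d : ℤ} (h : z = x + 1) (h' : c = a + 1) :
    joins (x, y) (z, w) (a, b) (c, d) = if a = x ∧ b = y ∧ d = w then 1 else 0 := by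
  unfold joins
  congr 1
  simp only [eq_iff_iff, Prod.mk.injEq]
  omega

theorem crosses_of_eq {p : Pixel} {a b c d : ℤ} (h : c = a) :
    crosses p (a, b) (c, d) = 0 := by
  simp only [crosses]
  rw [if_neg (by omega)]

theorem joins_of_fst_eq {x y z w a b c d : ℤ} (h : z = x + 1) (h' : c = a) :
    joins (x, y) (z, w) (a, b) (c, d) = 0 := by
  unfold joins
  simp only [Prod.mk.injEq]
  rw [if_neg (by omega)]

theorem joins_vertical_of_lt {x y w a b c d : ℤ} (h' : c = a + 1) :
    joins (x, y) (x, w) (a, b) (c, d) = 0 := by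
  unfold joins
  simp only [Prod.mk.injEq]
  rw [if_neg (by omega)]

theorem eight_step_induction {C : Pixel → Pixel → Prop} (symm : ∀ a b, C a b → C b a)
    (vertical : ∀ a b d : ℤ, d = b + 1 → C (a, b) (a, d))
    (horizontal : ∀ a b d : ℤ, d ≤ b + 1 → b ≤ d + 1 → C (a, b) (a + 1, d))
    {a b : Pixel} (h : PixelAdj .eight a b) : C a b := by
  rw [pixelAdj_eight_iff] at h
  obtain ⟨u, v⟩ := a
  obtain ⟨c, d⟩ := b
  simp only at h
  obtain rfl | rfl | rfl : c = u + 1 ∨ u = c + 1 ∨ c = u := by omega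
  · exact horizontal _ _ _ (by omega) (by omega)
  · exact symm _ _ (horizontal _ _ _ (by omega) (by omega))
  · obtain h | h : d = v + 1 ∨ v = d + 1 := by omega
    · exact vertical _ _ _ h
    · exact symm _ _ (vertical _ _ _ h)

/-- The two rays lie above each other and differ only in the steps whose left end is `(x, y + 1)`;
the three terms are the possible right ends. -/
theorem crosses_vertical (x y : ℤ) {a b : Pixel} (h : PixelAdj .eight a b) :
    crosses (x, y) a b = crosses (x, y + 1) a b + joins (x, y + 1) (x + 1, y) a b +
      joins (x, y + 1) (x + 1, y + 1) a b + joins (x, y + 1) (x + 1, y + 2) a b := by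
  refine eight_step_induction (C := fun a b =>
    crosses (x, y) a b = crosses (x, y + 1) a b +
      joins (x, y + 1) (x + 1, y) a b + joins (x, y + 1) (x + 1, y + 1) a b +
      joins (x, y + 1) (x + 1, y + 2) a b)
    (fun a b h => ?_) (fun a b d h => ?_) (fun a b d h h' => ?_) h
  · simpa only [crosses_symm _ b a, joins_symm _ _ b a] using h
  · rw [crosses_of_eq rfl, crosses_of_eq rfl, joins_of_fst_eq rfl rfl, joins_of_fst_eq rfl rfl,
      joins_of_fst_eq rfl rfl]
    rfl
  · rw [crosses_of_lt rfl, crosses_of_lt rfl, joins_of_lt rfl rfl, joins_of_lt rfl rfl,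
      joins_of_lt rfl rfl]
    by_cases hx : a = x
    · by_cases hb : b = y + 1
      · obtain rfl | rfl | rfl : d = y ∨ d = y + 1 ∨ d = y + 2 := by omega
        all_goals simp [hx, hb]
      · have : y < b ↔ y + 1 < b := by omega
        simp [hx, hb, this]
    · simp [hx]

/-- The correction on the left is the coboundary of the indicator of the half column above `(x + 1,
y)`, whose total over a cycle vanishes. Steps leaving this half column to the left are counted by
their right end, whereas `crosses` looks at the left end; the two diagonals account for the
discrepancy, and the last term is the step through the bottom of the half column. -/
theorem crosses_horizontal (x y : ℤ) {a b : Pixel} (h : PixelAdj .eight a b) :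
    crosses (x, y) a b + ((if a.1 = x + 1 ∧ y < a.2 then 1 else 0) +
        (if b.1 = x + 1 ∧ y < b.2 then 1 else 0)) =
      crosses (x + 1, y) a b + joins (x, y) (x + 1, y + 1) a b +
      joins (x, y + 1) (x + 1, y) a b + joins (x + 1, y + 1) (x + 1, y) a b := by
  refine eight_step_induction (C := fun a b =>
    crosses (x, y) a b + ((if a.1 = x + 1 ∧ y < a.2 then 1 else 0) +
        (if b.1 = x + 1 ∧ y < b.2 then 1 else 0)) =
      crosses (x + 1, y) a b + joins (x, y) (x + 1, y + 1) a b +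
      joins (x, y + 1) (x + 1, y) a b + joins (x + 1, y + 1) (x + 1, y) a b)
    (fun a b h => ?_) (fun a b d h => ?_) (fun a b d h h' => ?_) h
  · rw [crosses_symm _ b a, crosses_symm _ b a, joins_symm _ _ b a, joins_symm _ _ b a,
      joins_symm _ _ b a, ← h]
    ring
  · rw [crosses_of_eq rfl, crosses_of_eq rfl, joins_of_fst_eq rfl rfl, joins_of_fst_eq rfl rfl]
    subst h
    by_cases hx : a = x + 1
    · by_cases hb : b = y
      · simp [joins, hx, hb]
      · have : y < b + 1 ↔ y < b := by omega
        simp only [joins, hx, hb, this, Prod.mk.injEq, true_and, false_and, and_false, or_self,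
          if_false, add_zero, zero_add, show ¬ (b = y + 1 ∧ b + 1 = y) by omega]
        split_ifs <;> rfl
    · simp [joins, hx]
  · rw [crosses_of_lt rfl, crosses_of_lt rfl, joins_of_lt rfl rfl, joins_of_lt rfl rfl,
      joins_vertical_of_lt rfl]
    by_cases hx : a = x + 1
    · simp [hx]
    · by_cases hx' : a = x
      · subst hx'
        obtain hb | hb | hb | hb : b < y ∨ b = y ∨ b = y + 1 ∨ y + 1 < b := by omega
        · simp [show ¬ y < b by omega, show ¬ y < d by omega, show b ≠ y by omega,
            show b ≠ y + 1 by omega]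
        · subst hb
          obtain h | h : d = b + 1 ∨ d < b + 1 := by omega
          · simp [h]
          · simp [show ¬ b < d by omega, show d ≠ b + 1 by omega]
        · obtain h | h : d = y ∨ y < d := by omega
          · simp [h, hb]
          · simp [h, hb, show d ≠ y by omega, CharTwo.add_self_eq_zero]
        · simp [show y < b by omega, show y < d by omega, show b ≠ y by omega,
            show b ≠ y + 1 by omega, CharTwo.add_self_eq_zero]
      · simp [hx, hx']

theorem parity_vertical {L : List (Pixel × Pixel)} (hL : IsCycle L) (x y : ℤ) :
    parity L (x, y) = parity L (x, y + 1) + mult L (x, y + 1) (x + 1, y) +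
      mult L (x, y + 1) (x + 1, y + 1) + mult L (x, y + 1) (x + 1, y + 2) := by
  unfold parity mult
  rw [← stepSum_add, ← stepSum_add, ← stepSum_add]
  exact stepSum_congr fun s hs => crosses_vertical x y (hL.adj s hs)

theorem parity_horizontal {L : List (Pixel × Pixel)} (hL : IsCycle L) (x y : ℤ) :
    parity L (x, y) = parity L (x + 1, y) + mult L (x, y) (x + 1, y + 1) +
      mult L (x, y + 1) (x + 1, y) + mult L (x + 1, y + 1) (x + 1, y) := by
  have hb := hL.boundary fun p => if p.1 = x + 1 ∧ y < p.2 then 1 else 0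
  rw [← add_zero (parity L (x, y)), ← hb]
  unfold parity mult
  rw [← stepSum_add, ← stepSum_add, ← stepSum_add, ← stepSum_add]
  exact stepSum_congr fun s hs => crosses_horizontal x y (hL.adj s hs)

/-- No step of `L` starts or ends at `p`. -/
def Avoids (L : List (Pixel × Pixel)) (p : Pixel) : Prop := ∀ s ∈ L, s.1 ≠ p ∧ s.2 ≠ p

theorem mult_eq_zero {L : List (Pixel × Pixel)} {p q : Pixel}
    (h : ∀ s ∈ L, ¬ (s.1 = p ∧ s.2 = q) ∧ ¬ (s.1 = q ∧ s.2 = p)) : mult L p q = 0 := by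
  have : stepSum L (joins p q) = stepSum L (fun _ _ => 0) := by
    refine stepSum_congr fun s hs => ?_
    have := h s hs
    unfold joins
    rw [if_neg (by tauto)]
  rw [mult, this]
  simp [stepSum]

theorem Avoids.mult_left {L : List (Pixel × Pixel)} {p : Pixel} (h : Avoids L p) (q : Pixel) :
    mult L p q = 0 :=
  mult_eq_zero fun s hs => ⟨fun e => (h s hs).1 e.1, fun e => (h s hs).2 e.2⟩

theorem Avoids.mult_right {L : List (Pixel × Pixel)} {p : Pixel} (h : Avoids L p) (q : Pixel) :
    mult L q p = 0 :=
  mult_eq_zero fun s hs => ⟨fun e => (h s hs).2 e.2, fun e => (h s hs).1 e.1⟩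

/-- For a diagonal step `hx` excludes the crossing diagonal. For a horizontal or vertical step the
pair in `hx` is `p`, `q` itself, so `hx` adds nothing to `hp` and `hq`. -/
theorem parity_eq_of_adj_aux {L : List (Pixel × Pixel)} (hL : IsCycle L) {p q : Pixel}
    (hp : Avoids L p) (hq : Avoids L q) (hle : p.1 < q.1 ∨ (p.1 = q.1 ∧ p.2 < q.2))
    (hpq : PixelAdj .eight p q)
    (hx : mult L (p.1, q.2) (q.1, p.2) = 0) : parity L p = parity L q := by
  obtain ⟨x, y⟩ := p
  obtain ⟨x', y'⟩ := q
  rw [pixelAdj_eight_iff] at hpq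
  simp only at hpq hle hx
  rcases hle with hlt | ⟨rfl, hlt⟩
  · obtain rfl : x' = x + 1 := by omega
    obtain rfl | rfl | rfl : y' = y + 1 ∨ y' = y ∨ y = y' + 1 := by omega
    · rw [parity_horizontal hL, parity_vertical hL, hp.mult_left, hq.mult_left, hq.mult_left,
        hq.mult_left, hq.mult_left, hx]
      simp
    · rw [parity_horizontal hL, hp.mult_left, hq.mult_right, hq.mult_right]
      simp
    · have h1 := parity_vertical hL x y'
      have h2 := parity_horizontal hL x y'
      rw [hp.mult_left, hp.mult_left, hp.mult_left] at h1
      rw [hp.mult_left, hq.mult_right, hx] at h2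
      simp only [add_zero] at h1 h2
      rw [← h1, h2]
  · obtain rfl : y' = y + 1 := by omega
    rw [parity_vertical hL, hq.mult_left, hq.mult_left, hq.mult_left]
    simp

theorem mult_comm (L : List (Pixel × Pixel)) (p q : Pixel) : mult L p q = mult L q p := by
  refine stepSum_congr fun s _ => ?_
  simp only [joins, or_comm]

/-- The parity is the same at `8`-adjacent pixels off the cycle, unless the cycle contains the
diagonal that crosses the step between them. -/
theorem parity_eq_of_adj {L : List (Pixel × Pixel)} (hL : IsCycle L) {p q : Pixel}
    (hp : Avoids L p) (hq : Avoids L q) (hpq : PixelAdj .eight p q)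
    (hx : mult L (p.1, q.2) (q.1, p.2) = 0) : parity L p = parity L q := by
  have h := pixelAdj_eight_iff.1 hpq
  rcases lt_trichotomy p.1 q.1 with hlt | heq | hlt
  · exact parity_eq_of_adj_aux hL hp hq (Or.inl hlt) hpq hx
  · rcases lt_trichotomy p.2 q.2 with hlt' | heq' | hlt'
    · exact parity_eq_of_adj_aux hL hp hq (Or.inr ⟨heq, hlt'⟩) hpq hx
    · omega
    · exact (parity_eq_of_adj_aux hL hq hp (Or.inr ⟨heq.symm, hlt'⟩) hpq.symm
        (by rwa [mult_comm])).symm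
  · exact (parity_eq_of_adj_aux hL hq hp (Or.inl hlt) hpq.symm (by rwa [mult_comm])).symm

/-- Turns a path into a mod 2 chain with boundary `e + e'`, ready to be closed to a cycle. -/
theorem exists_chain {R : Pixel → Pixel → Prop} {e e' : Pixel} (h : Relation.ReflTransGen R e e') :
    ∃ L : List (Pixel × Pixel), (∀ s ∈ L, R s.1 s.2) ∧
      ∀ f : Pixel → ZMod 2, stepSum L (fun a b => f a + f b) = f e + f e' := by
  induction h with
  | refl => exact ⟨[], by simp, fun f => by simp [stepSum, CharTwo.add_self_eq_zero]⟩
  | @tail b c _ hbc ih =>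
    obtain ⟨L, hL, hf⟩ := ih
    refine ⟨L ++ [(b, c)], ?_, fun f => ?_⟩
    · intro s hs
      rcases List.mem_append.1 hs with hs | hs
      · exact hL s hs
      · simp only [List.mem_singleton] at hs
        subst hs
        exact hbc
    · rw [stepSum_append, hf]
      simp only [stepSum, List.map_cons, List.map_nil, List.sum_cons, List.sum_nil, add_zero]
      linear_combination CharTwo.add_self_eq_zero (f b)

end DigitalImage

/-! ### Separations of the grid and constancy of the parity -/

namespace DigitalImage

/-- Points that are neither exterior nor interior. -/
def middle (E N : Set Pixel) : Set Pixel := {q | q ∉ E ∧ q ∉ N}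

/-- A partition of the pixels into an `α`-connected set `E`, a set `N` that is not `α`-adjacent to
`E`, and a common boundary `middle E N` of both, such that the complement of `E` remains connected
when two points of the boundary are deleted. -/
structure Separation (α : Connectivity) (E N : Set Pixel) : Prop where
  disjoint : ∀ z, z ∈ E → z ∉ N
  not_adj : ∀ n ∈ N, ∀ e ∈ E, ¬ PixelAdj α n e
  exists_exterior : ∀ q ∈ middle E N, ∃ e ∈ E, PixelAdj α q e
  exists_interior : ∀ q ∈ middle E N, ∃ n ∈ N, PixelAdj α q n
  connected : ∀ e ∈ E, ∀ e' ∈ E,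
    Relation.ReflTransGen (fun a b => a ∈ E ∧ b ∈ E ∧ PixelAdj α a b) e e'
  compl_connected : ∀ q ∈ middle E N, ∀ q' ∈ middle E N,
    ∀ k, k ∉ E → k ≠ q → k ≠ q' → ∀ k', k' ∉ E → k' ≠ q → k' ≠ q' →
      Relation.ReflTransGen (fun a b => PixelAdj α a b ∧ (a ∉ E ∧ a ≠ q ∧ a ≠ q') ∧
        (b ∉ E ∧ b ≠ q ∧ b ≠ q') ∧ (a ∈ N ∨ b ∈ N)) k k'

namespace Separation

variable {α : Connectivity} {E N : Set Pixel}

/-- Transport along grid symmetries, so that only horizontal edges and one orientation have to be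
treated. -/
theorem comap (h : Separation α E N) (σ : Pixel ≃ Pixel)
    (hσ : ∀ a b, PixelAdj α (σ a) (σ b) ↔ PixelAdj α a b) :
    Separation α (σ ⁻¹' E) (σ ⁻¹' N) := by
  have hσ' : ∀ a b, PixelAdj α (σ.symm a) (σ.symm b) ↔ PixelAdj α a b := fun a b => by
    rw [← hσ, σ.apply_symm_apply, σ.apply_symm_apply]
  refine ⟨fun z hz => h.disjoint _ hz, fun n hn e he hne => h.not_adj _ hn _ he ((hσ _ _).2 hne),
    fun q hq => ?_, fun q hq => ?_, fun e he e' he' => ?_,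
    fun q hq q' hq' k hk hkq hkq' k' hk' hkq2 hkq2' => ?_⟩
  · obtain ⟨e, he, hqe⟩ := h.exists_exterior (σ q) hq
    exact ⟨σ.symm e, by simpa using he, by rwa [← hσ, σ.apply_symm_apply]⟩
  · obtain ⟨e, he, hqe⟩ := h.exists_interior (σ q) hq
    exact ⟨σ.symm e, by simpa using he, by rwa [← hσ, σ.apply_symm_apply]⟩
  · have := (h.connected _ he _ he').lift (p := fun a b => a ∈ σ ⁻¹' E ∧ b ∈ σ ⁻¹' E ∧ PixelAdj α a b)
      σ.symm (fun a b hab => ⟨by simpa using hab.1, by simpa using hab.2.1, (hσ' _ _).2 hab.2.2⟩)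
    simpa [Function.onFun] using this
  · have := (h.compl_connected (σ q) hq (σ q') hq' (σ k) hk (σ.injective.ne hkq)
      (σ.injective.ne hkq') (σ k') hk' (σ.injective.ne hkq2) (σ.injective.ne hkq2')).lift
      (p := fun a b => PixelAdj α a b ∧ (a ∉ σ ⁻¹' E ∧ a ≠ q ∧ a ≠ q') ∧
        (b ∉ σ ⁻¹' E ∧ b ≠ q ∧ b ≠ q') ∧ (a ∈ σ ⁻¹' N ∨ b ∈ σ ⁻¹' N)) σ.symm ?_
    · simpa [Function.onFun] using this
    · rintro a b ⟨h1, ⟨h2, h3, h4⟩, ⟨h5, h6, h7⟩, h8⟩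
      refine ⟨(hσ' _ _).2 h1, ⟨by simpa using h2, ?_, ?_⟩, ⟨by simpa using h5, ?_, ?_⟩,
        by simpa using h8⟩ <;> rwa [Ne, σ.symm_apply_eq]

/-- Reflection in the vertical axis. -/
def reflectFst : Pixel ≃ Pixel := (Equiv.neg ℤ).prodCongr (Equiv.refl ℤ)

/-- Reflection in the horizontal axis. -/
def reflectSnd : Pixel ≃ Pixel := (Equiv.refl ℤ).prodCongr (Equiv.neg ℤ)

theorem swap (h : Separation α E N) : Separation α (Prod.swap ⁻¹' E) (Prod.swap ⁻¹' N) := by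
  refine h.comap (Equiv.prodComm ℤ ℤ) fun a b => ?_
  cases α
  · simp only [pixelAdj_four_iff, Equiv.prodComm_apply, Prod.fst_swap, Prod.snd_swap]
    omega
  · simp only [pixelAdj_eight_iff, Equiv.prodComm_apply, Prod.fst_swap, Prod.snd_swap]
    omega

theorem reflect_fst (h : Separation α E N) :
    Separation α (reflectFst ⁻¹' E) (reflectFst ⁻¹' N) := by
  refine h.comap reflectFst fun a b => ?_
  cases α
  · simp only [pixelAdj_four_iff, reflectFst, Equiv.prodCongr_apply, Prod.map_fst, Prod.map_snd,
      Equiv.neg_apply, Equiv.refl_apply]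
    omega
  · simp only [pixelAdj_eight_iff, reflectFst, Equiv.prodCongr_apply, Prod.map_fst, Prod.map_snd,
      Equiv.neg_apply, Equiv.refl_apply]
    omega

theorem reflect_snd (h : Separation α E N) :
    Separation α (reflectSnd ⁻¹' E) (reflectSnd ⁻¹' N) := by
  refine h.comap reflectSnd fun a b => ?_
  cases α
  · simp only [pixelAdj_four_iff, reflectSnd, Equiv.prodCongr_apply, Prod.map_fst, Prod.map_snd,
      Equiv.neg_apply, Equiv.refl_apply]
    omega
  · simp only [pixelAdj_eight_iff, reflectSnd, Equiv.prodCongr_apply, Prod.map_fst, Prod.map_snd,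
      Equiv.neg_apply, Equiv.refl_apply]
    omega

@[simp] theorem reflectFst_apply (x y : ℤ) : reflectFst (x, y) = (-x, y) := rfl

@[simp] theorem reflectSnd_apply (x y : ℤ) : reflectSnd (x, y) = (x, -y) := rfl

/-- The parity with respect to a cycle in `E ∪ {q, q'}` is constant on the rest of the complement
of `E`. -/
theorem parity_eq (h : Separation α E N) {q q' : Pixel} (hq : q ∈ middle E N)
    (hq' : q' ∈ middle E N) {L : List (Pixel × Pixel)} (hL : IsCycle L)
    (hav : ∀ p, p ∉ E → p ≠ q → p ≠ q' → Avoids L p)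
    (hE : ∀ s ∈ L, (s.1 ∈ E ∨ s.2 ∈ E) ∨ PixelAdj α.dual s.1 s.2)
    {k k' : Pixel} (hk : k ∉ E) (hkq : k ≠ q) (hkq' : k ≠ q') (hk' : k' ∉ E) (hkq2 : k' ≠ q)
    (hkq2' : k' ≠ q') : parity L k = parity L k' := by
  induction h.compl_connected q hq q' hq' k hk hkq hkq' k' hk' hkq2 hkq2' with
  | refl => rfl
  | @tail b c _ hbc ih =>
    obtain ⟨hadj, ⟨hb, hbq, hbq'⟩, ⟨hc, hcq, hcq'⟩, hN⟩ := hbc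
    rw [ih hb hbq hbq']
    have hbL := hav b hb hbq hbq'
    have hcL := hav c hc hcq hcq'
    refine parity_eq_of_adj hL hbL hcL hadj.eight ?_
    by_cases h1 : b.1 = c.1
    · rw [show (b.1, c.2) = c from Prod.ext h1 rfl]
      exact hcL.mult_left _
    by_cases h2 : b.2 = c.2
    · rw [show (b.1, c.2) = b from Prod.ext rfl h2.symm]
      exact hbL.mult_left _
    cases α with
    | four => rw [pixelAdj_four_iff] at hadj; omega
    | eight =>
      have hadj' := pixelAdj_eight_iff.1 hadj
      -- A cycle step along the crossing diagonal is excluded. Both of its ends are 8-adjacent to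
      -- `b` and to `c`, one of which lies in `N`, so neither end lies in `E`; and a diagonal is not
      -- a 4-adjacency. This is why the paths of `compl_connected` must use a point of `N` in every
      -- step.
      have key : ∀ u v : Pixel, u.1 = b.1 ∧ u.2 = c.2 ∧ v.1 = c.1 ∧ v.2 = b.2 →
          ¬ ((u ∈ E ∨ v ∈ E) ∨ PixelAdj .four u v) := by
        rintro u v ⟨hu1, hu2, hv1, hv2⟩ ((hu | hv) | huv)
        · rcases hN with hN | hN
          · exact h.not_adj _ hN _ hu (pixelAdj_eight_iff.2 (by omega))
          · exact h.not_adj _ hN _ hu (pixelAdj_eight_iff.2 (by omega))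
        · rcases hN with hN | hN
          · exact h.not_adj _ hN _ hv (pixelAdj_eight_iff.2 (by omega))
          · exact h.not_adj _ hN _ hv (pixelAdj_eight_iff.2 (by omega))
        · rw [pixelAdj_four_iff] at huv
          omega
      refine mult_eq_zero fun s hs => ⟨fun hs' => ?_, fun hs' => ?_⟩
      · exact key s.1 s.2 (by rw [hs'.1, hs'.2]; simp) (hE s hs)
      · refine key s.2 s.1 (by rw [hs'.1, hs'.2]; simp) ?_
        rw [or_comm (a := s.2 ∈ E)]
        exact (hE s hs).imp id PixelAdj.symm

theorem mult_append_of_notMem {C M : List (Pixel × Pixel)} {p : Pixel}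
    (hC : ∀ s ∈ C, s.1 ∈ E ∧ s.2 ∈ E ∧ PixelAdj α s.1 s.2) (hp : p ∉ E) (z : Pixel) :
    mult (C ++ M) p z = stepSum M (joins p z) := by
  rw [mult, stepSum_append, ← mult, mult_eq_zero, zero_add]
  exact fun s hs => ⟨fun e => hp (e.1 ▸ (hC s hs).1), fun e => hp (e.2 ▸ (hC s hs).2.1)⟩

/-- Two points of the boundary are joined by a path through `E`, which is closed by the step
between them. -/
theorem exists_cycle (h : Separation α E N) {q q' : Pixel} (hq : q ∈ middle E N)
    (hq' : q' ∈ middle E N) (hqq' : PixelAdj α.dual q q') :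
    ∃ L, IsCycle L ∧ (∀ p, p ∉ E → p ≠ q → p ≠ q' → Avoids L p) ∧ mult L q q' = 1 ∧
      (∀ s ∈ L, PixelAdj α s.1 s.2 ∨ s = (q', q)) ∧
      (∀ k k', k ∉ E → k ≠ q → k ≠ q' → k' ∉ E → k' ≠ q → k' ≠ q' → parity L k = parity L k') := by
  obtain ⟨e, he, hqe⟩ := h.exists_exterior q hq
  obtain ⟨e', he', hqe'⟩ := h.exists_exterior q' hq'
  obtain ⟨C, hC, hb⟩ := exists_chain (h.connected e he e' he')
  have hmem : ∀ s ∈ C ++ [(q, e), (e', q'), (q', q)],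
      s ∈ C ∨ s = (q, e) ∨ s = (e', q') ∨ s = (q', q) := by simp
  have hcyc : IsCycle (C ++ [(q, e), (e', q'), (q', q)]) := by
    refine ⟨fun s hs => ?_, fun f => ?_⟩
    · rcases hmem s hs with hs | rfl | rfl | rfl
      · exact (hC s hs).2.2.eight
      · exact hqe.eight
      · exact hqe'.symm.eight
      · exact hqq'.symm.eight
    · rw [stepSum_append, hb]
      simp only [stepSum, List.map_cons, List.map_nil, List.sum_cons, List.sum_nil, add_zero]
      linear_combination CharTwo.add_self_eq_zero (f e) + CharTwo.add_self_eq_zero (f e') +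
        CharTwo.add_self_eq_zero (f q) + CharTwo.add_self_eq_zero (f q')
  have hav : ∀ p, p ∉ E → p ≠ q → p ≠ q' → Avoids (C ++ [(q, e), (e', q'), (q', q)]) p := by
    intro p hp hpq hpq' s hs
    rcases hmem s hs with hs | rfl | rfl | rfl
    · exact ⟨fun e => hp (e ▸ (hC s hs).1), fun e => hp (e ▸ (hC s hs).2.1)⟩
    · exact ⟨hpq.symm, fun h => hp (h ▸ he)⟩
    · exact ⟨fun h => hp (h ▸ he'), hpq'.symm⟩
    · exact ⟨hpq'.symm, hpq.symm⟩
  refine ⟨_, hcyc, hav, ?_, fun s hs => ?_, fun k k' h1 h2 h3 h4 h5 h6 =>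
    h.parity_eq hq hq' hcyc hav (fun s hs => ?_) h1 h2 h3 h4 h5 h6⟩
  -- The path `C` stays in `E` and `q` does not, so only the closing step contributes.
  · rw [mult_append_of_notMem hC hq.1]
    have h1 : e ≠ q' := fun h => hq'.1 (h ▸ he)
    have h2 : e' ≠ q := fun h => hq.1 (h ▸ he')
    simp [stepSum, joins, h1, h2, hqq'.ne, hqq'.ne.symm]
  · rcases hmem s hs with hs | rfl | rfl | rfl
    · exact Or.inl (hC s hs).2.2
    · exact Or.inl hqe
    · exact Or.inl hqe'.symm
    · exact Or.inr rfl
  · rcases hmem s hs with hs | rfl | rfl | rfl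
    · exact Or.inl (Or.inl (hC s hs).1)
    · exact Or.inl (Or.inr he)
    · exact Or.inl (Or.inl he')
    · exact Or.inr hqq'.symm

/-- Two neighbours in `E` of a point of the boundary are joined by a path in `E`, which is closed
through that point. -/
theorem exists_cycle_through (h : Separation α E N) {q e e' : Pixel} (hq : q ∈ middle E N)
    (he : e ∈ E) (he' : e' ∈ E) (hqe : PixelAdj α q e) (hqe' : PixelAdj α q e') :
    ∃ L, IsCycle L ∧ (∀ p, p ∉ E → p ≠ q → Avoids L p) ∧
      (∀ z, mult L q z = joins q z q e + joins q z q e') ∧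
      (∀ s ∈ L, PixelAdj α s.1 s.2) ∧
      (∀ k k', k ∉ E → k ≠ q → k' ∉ E → k' ≠ q → parity L k = parity L k') := by
  obtain ⟨C, hC, hb⟩ := exists_chain (h.connected e he e' he')
  have hmem : ∀ s ∈ C ++ [(q, e), (q, e')], s ∈ C ∨ s = (q, e) ∨ s = (q, e') := by simp
  have hcyc : IsCycle (C ++ [(q, e), (q, e')]) := by
    refine ⟨fun s hs => ?_, fun f => ?_⟩
    · rcases hmem s hs with hs | rfl | rfl
      · exact (hC s hs).2.2.eight
      · exact hqe.eight
      · exact hqe'.eight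
    · rw [stepSum_append, hb]
      simp only [stepSum, List.map_cons, List.map_nil, List.sum_cons, List.sum_nil, add_zero]
      linear_combination CharTwo.add_self_eq_zero (f e) + CharTwo.add_self_eq_zero (f e') +
        CharTwo.add_self_eq_zero (f q)
  have hav : ∀ p, p ∉ E → p ≠ q → Avoids (C ++ [(q, e), (q, e')]) p := by
    intro p hp hpq s hs
    rcases hmem s hs with hs | rfl | rfl
    · exact ⟨fun e => hp (e ▸ (hC s hs).1), fun e => hp (e ▸ (hC s hs).2.1)⟩
    · exact ⟨hpq.symm, fun h => hp (h ▸ he)⟩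
    · exact ⟨hpq.symm, fun h => hp (h ▸ he')⟩
  refine ⟨_, hcyc, hav, fun z => ?_, fun s hs => ?_, fun k k' h1 h2 h4 h5 =>
    h.parity_eq hq hq hcyc (fun p h1 h2 _ => hav p h1 h2) (fun s hs => ?_) h1 h2 h2 h4 h5 h5⟩
  · rw [mult_append_of_notMem hC hq.1]
    simp [stepSum]
  · rcases hmem s hs with hs | rfl | rfl
    · exact (hC s hs).2.2
    · exact hqe
    · exact hqe'
  · rcases hmem s hs with hs | rfl | rfl
    · exact Or.inl (Or.inl (hC s hs).1)
    · exact Or.inl (Or.inr he)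
    · exact Or.inl (Or.inr he')

end Separation

theorem mult_eq_zero_of_not_adj {L : List (Pixel × Pixel)}
    (hL : ∀ s ∈ L, PixelAdj .four s.1 s.2) {p q : Pixel} (h : ¬ PixelAdj .four p q) :
    mult L p q = 0 :=
  mult_eq_zero fun s hs => ⟨fun e => h (e.1 ▸ e.2 ▸ hL s hs), fun e => h (e.1 ▸ e.2 ▸ (hL s hs).symm)⟩

theorem parity_vertical_of_four {L : List (Pixel × Pixel)} (hL : IsCycle L)
    (h4 : ∀ s ∈ L, PixelAdj .four s.1 s.2) (x y : ℤ) :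
    parity L (x, y) = parity L (x, y + 1) + mult L (x, y + 1) (x + 1, y + 1) := by
  rw [parity_vertical hL, mult_eq_zero_of_not_adj h4, mult_eq_zero_of_not_adj h4 (q := (_, y + 2))]
  · ring
  · rw [pixelAdj_four_iff]; simp only; omega
  · rw [pixelAdj_four_iff]; simp only; omega

theorem parity_horizontal_of_four {L : List (Pixel × Pixel)} (hL : IsCycle L)
    (h4 : ∀ s ∈ L, PixelAdj .four s.1 s.2) (x y : ℤ) :
    parity L (x, y) = parity L (x + 1, y) + mult L (x + 1, y + 1) (x + 1, y) := by
  rw [parity_horizontal hL, mult_eq_zero_of_not_adj h4,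
    mult_eq_zero_of_not_adj h4 (p := (x, y + 1))]
  · ring
  · rw [pixelAdj_four_iff]; simp only; omega
  · rw [pixelAdj_four_iff]; simp only; omega

end DigitalImage

/-! ### Local structure of the boundary of a separation -/

namespace DigitalImage

namespace Separation

variable {α : Connectivity} {E N : Set Pixel} {x y : ℤ}

theorem pixelAdj_dual_right (α : Connectivity) (x y : ℤ) : PixelAdj α.dual (x, y) (x + 1, y) :=
  PixelAdj.of_four (pixelAdj_four_iff.2 (by simp))

/-- Horizontally adjacent boundary points, case `α = 4`: one of the two sides is exterior. -/
theorem four_side_exterior (h : Separation .four E N) (hq : (x, y) ∈ middle E N)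
    (hq' : (x + 1, y) ∈ middle E N) :
    ((x, y + 1) ∈ E ∧ (x + 1, y + 1) ∈ E) ∨ ((x, y - 1) ∈ E ∧ (x + 1, y - 1) ∈ E) := by
  by_contra hcon
  obtain ⟨L, hL, hav, hm, hs, hpar⟩ := h.exists_cycle hq hq' (pixelAdj_dual_right _ x y)
  have h4 : ∀ s ∈ L, PixelAdj .four s.1 s.2 := fun s hs' => (hs s hs').elim id fun e => by
    rw [e, pixelAdj_four_iff]
    simp
  -- The ray of `(x, y)` misses the closing edge while the ray of `(x, y - 1)` meets it once. Hence
  -- a non-exterior pixel above the edge has the parity of `(x, y)` and one below has the opposite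
  -- parity, against constancy.
  have hup : ∃ u, u ∉ E ∧ u ≠ (x, y) ∧ u ≠ (x + 1, y) ∧ parity L u = parity L (x, y) := by
    by_cases hu : (x, y + 1) ∈ E
    · have hu' : (x + 1, y + 1) ∉ E := fun h' => hcon (Or.inl ⟨hu, h'⟩)
      have hav' := hav _ hu' (by simp) (by simp)
      refine ⟨_, hu', by simp, by simp, ?_⟩
      rw [parity_vertical_of_four hL h4 x y, hav'.mult_right,
        parity_horizontal_of_four hL h4 x (y + 1), hav'.mult_right]
      simp
    · refine ⟨_, hu, by simp, by simp, ?_⟩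
      rw [parity_vertical_of_four hL h4 x y, (hav _ hu (by simp) (by simp)).mult_left]
      simp
  have hdown : ∃ u, u ∉ E ∧ u ≠ (x, y) ∧ u ≠ (x + 1, y) ∧ parity L u = parity L (x, y) + 1 := by
    have h1 := parity_vertical_of_four hL h4 x (y - 1)
    rw [sub_add_cancel, hm] at h1
    by_cases hu : (x, y - 1) ∈ E
    · have hu' : (x + 1, y - 1) ∉ E := fun h' => hcon (Or.inr ⟨hu, h'⟩)
      have hav' := hav _ hu' (by simp) (by simp)
      refine ⟨_, hu', by simp, by simp, ?_⟩
      rw [← h1, parity_horizontal_of_four hL h4 x (y - 1), hav'.mult_right]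
      simp
    · exact ⟨_, hu, by simp, by simp, h1⟩
  obtain ⟨u, hu1, hu2, hu3, hu⟩ := hup
  obtain ⟨v, hv1, hv2, hv3, hv⟩ := hdown
  have := hpar u v hu1 hu2 hu3 hv1 hv2 hv3
  rw [hu, hv] at this
  simp at this

/-- Horizontally adjacent boundary points, case `α = 8`: one of the two sides meets the
exterior. -/
theorem eight_side_exterior (h : Separation .eight E N) (hq : (x, y) ∈ middle E N)
    (hq' : (x + 1, y) ∈ middle E N) :
    ((x, y + 1) ∈ E ∨ (x + 1, y + 1) ∈ E) ∨ ((x, y - 1) ∈ E ∨ (x + 1, y - 1) ∈ E) := by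
  by_contra hcon
  simp only [not_or] at hcon
  obtain ⟨⟨hu, hu'⟩, hv, hv'⟩ := hcon
  obtain ⟨L, hL, hav, hm, hs, hpar⟩ := h.exists_cycle hq hq' (pixelAdj_dual_right _ x y)
  have h1 := parity_vertical hL x y
  have h2 := parity_vertical hL x (y - 1)
  have hau := hav _ hu (by simp) (by simp)
  rw [hau.mult_left, hau.mult_left, hau.mult_left] at h1
  rw [sub_add_cancel, show y - 1 + 2 = y + 1 by ring, hm,
    (hav _ hv' (by simp) (by simp)).mult_right, (hav _ hu' (by simp) (by simp)).mult_right] at h2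
  have := hpar _ _ hu (by simp) (by simp) hv (by simp) (by simp)
  rw [h2, h1] at this
  simp at this

/-- Diagonally adjacent boundary points, case `α = 4`: one of the two other corners of the cell is
exterior. -/
theorem four_diag_exterior (h : Separation .four E N) (hq : (x, y) ∈ middle E N)
    (hq' : (x + 1, y + 1) ∈ middle E N) : (x, y + 1) ∈ E ∨ (x + 1, y) ∈ E := by
  by_contra hcon
  simp only [not_or] at hcon
  obtain ⟨hu, hv⟩ := hcon
  obtain ⟨L, hL, hav, hm, hs, hpar⟩ := h.exists_cycle hq hq'
    (pixelAdj_eight_iff.2 (by simp only; omega))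
  have h1 := parity_vertical hL x y
  have h2 := parity_horizontal hL x y
  have hau := hav _ hu (by simp) (by simp)
  have hav' := hav _ hv (by simp) (by simp)
  rw [hau.mult_left, hau.mult_left, hau.mult_left] at h1
  rw [hm, hau.mult_left, hav'.mult_right] at h2
  have := hpar _ _ hu (by simp) (by simp) hv (by simp) (by simp)
  rw [h1] at h2
  simp [this] at h2

/-- Diagonally adjacent boundary points, case `α = 4`: one of the two other corners of the cell is
not exterior. -/
theorem four_diag_interior (h : Separation .four E N) (hq : (x, y) ∈ middle E N)
    (hq' : (x + 1, y + 1) ∈ middle E N) (hu : (x, y + 1) ∈ E) (hv : (x + 1, y) ∈ E) : False := by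
  obtain ⟨n, hn, hqn⟩ := h.exists_interior _ hq
  have hnE : n ∉ E := fun hE => h.disjoint _ hE hn
  obtain ⟨L, hL, hav, hm, h4, hpar⟩ := h.exists_cycle_through hq hu hv
    (pixelAdj_four_iff.2 (by simp)) (pixelAdj_four_iff.2 (by simp))
  have hnL : Avoids L n := hav _ hnE hqn.ne.symm
  have hq'q : (x + 1, y + 1) ≠ (x, y) := by simp
  have hq'L : Avoids L (x + 1, y + 1) := hav _ hq'.1 hq'q
  have h1 := parity_vertical_of_four hL h4 x y
  have h2 := parity_horizontal_of_four hL h4 x (y + 1)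
  rw [hq'L.mult_right] at h1 h2
  have h3 := hpar n _ hnE hqn.ne.symm hq'.1 hq'q
  -- The neighbours of `q` above and to the right are in `E`, so `n` is to the left or below.
  -- Reaching it from the cell means crossing one of the two cycle steps at `q`, while `q'` has the
  -- parity of `(x, y)`.
  have h4' : parity L n = parity L (x, y) + 1 := by
    have hn' : n = (x - 1, y) ∨ n = (x, y - 1) := by
      have hnu : n ≠ (x, y + 1) := fun e => hnE (e ▸ hu)
      have hnv : n ≠ (x + 1, y) := fun e => hnE (e ▸ hv)
      rw [pixelAdj_four_iff] at hqn
      obtain ⟨a, b⟩ := n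
      simp only [ne_eq, Prod.mk.injEq] at *
      omega
    rcases hn' with rfl | rfl
    · have := parity_horizontal_of_four hL h4 (x - 1) y
      rw [sub_add_cancel, mult_comm, hm] at this
      simpa [joins] using this
    · have := parity_vertical_of_four hL h4 x (y - 1)
      rw [sub_add_cancel, hm] at this
      simpa [joins] using this
  rw [h4', h1, h2] at h3
  simp at h3

/-- The two sides of an edge of the boundary cannot both meet the exterior. -/
theorem not_exterior_both_sides (h : Separation α E N) (hq : (x, y) ∈ middle E N)
    (hq' : (x + 1, y) ∈ middle E N) {e e' : Pixel} (he : e ∈ E) (he' : e' ∈ E)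
    (hqe : PixelAdj α (x, y) e) (hqe' : PixelAdj α (x, y) e')
    (h1 : e = (x, y + 1) ∨ e = (x + 1, y + 1)) (h2 : e' = (x, y - 1) ∨ e' = (x + 1, y - 1)) :
    False := by
  obtain ⟨n, hn, hqn⟩ := h.exists_interior _ hq
  have hnE : n ∉ E := fun hE => h.disjoint _ hE hn
  have hne := h.not_adj n hn e he
  have hne' := h.not_adj n hn e' he'
  have hnq' : n ≠ (x + 1, y) := fun e => hq'.2 (e ▸ hn)
  -- An interior neighbour of `(x, y)` in column `x` or `x + 1` would be equal or adjacent to `e` or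
  -- `e'`, or be a boundary point.
  have hn1 : n.1 = x - 1 := by
    have hne1 : n ≠ e := fun h => hnE (h ▸ he)
    have hne2 : n ≠ e' := fun h => hnE (h ▸ he')
    obtain ⟨a, b⟩ := n
    cases α
    · simp only [pixelAdj_four_iff, ne_eq, Prod.mk.injEq] at *
      rcases h1 with rfl | rfl <;> rcases h2 with rfl | rfl <;> simp only [Prod.mk.injEq] at * <;>
        omega
    · simp only [pixelAdj_eight_iff, ne_eq, Prod.mk.injEq] at *
      rcases h1 with rfl | rfl <;> rcases h2 with rfl | rfl <;> simp only [Prod.mk.injEq] at * <;>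
        omega
  have hw : (x - 1, y) ∉ E := fun hE => by
    by_cases hny : n = (x - 1, y)
    · exact hnE (hny ▸ hE)
    · refine h.not_adj n hn _ hE ?_
      obtain ⟨a, b⟩ := n
      cases α
      · simp only [pixelAdj_four_iff, Prod.mk.injEq] at *
        omega
      · simp only [pixelAdj_eight_iff, Prod.mk.injEq] at *
        omega
  obtain ⟨L, hL, hav, hm, -, hpar⟩ := h.exists_cycle_through hq he he' hqe hqe'
  have hnq : n ≠ (x, y) := hqn.ne.symm
  have hq'q : (x + 1, y) ≠ (x, y) := by simp
  have hwL : Avoids L (x - 1, y) := hav _ hw (by simp)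
  have hq'L : Avoids L (x + 1, y) := hav _ hq'.1 hq'q
  -- The parities at `(x - 1, y)` and `(x + 1, y)` differ by the number of cycle steps from `(x, y)`
  -- to the row above. That number is one, from `e` and not `e'`, so the cycle separates `n` from
  -- `(x + 1, y)`.
  have e1 := parity_horizontal hL x y
  have e2 := parity_horizontal hL (x - 1) y
  rw [show x - 1 + 1 = x by ring] at e2
  rw [hq'L.mult_right, hq'L.mult_right, hm] at e1
  rw [hwL.mult_left, mult_comm, hm, mult_comm, hm] at e2
  have e3 : parity L n = parity L (x - 1, y) := by
    obtain ⟨a, b⟩ := n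
    simp only at hn1
    subst hn1
    have hb : b = y ∨ b = y + 1 ∨ y = b + 1 := by
      have := pixelAdj_eight_iff.1 hqn.eight
      simp only at this
      omega
    rcases hb with rfl | rfl | rfl
    · rfl
    · have hnL : Avoids L _ := hav _ hnE hnq
      rw [parity_vertical hL (x - 1) y, hnL.mult_left, hnL.mult_left, hnL.mult_left]
      simp
    · rw [parity_vertical hL (x - 1) b, hwL.mult_left, hwL.mult_left, hwL.mult_left]
      simp
  have e4 := hpar n _ hnE hnq hq'.1 hq'q
  rw [e3, e2, e1] at e4
  revert e4
  rcases h1 with rfl | rfl <;> rcases h2 with rfl | rfl <;> 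
    simp [joins, show ¬ x = x - 1 by omega, show ¬ y - 1 = y + 1 by omega,
      show ¬ x + 1 = x - 1 by omega]

/-- If `(x, y + 1)` were a boundary point, the vertical edge below it would have an exterior side,
necessarily the left one. Then two neighbours of `(x, y)` are exterior and two are on the boundary,
which leaves none in `N`. -/
theorem four_interior_above (h : Separation .four E N) (hq : (x, y) ∈ middle E N)
    (hq' : (x + 1, y) ∈ middle E N) (hd : (x, y - 1) ∈ E) : (x, y + 1) ∈ N := by
  have hu : (x, y + 1) ∉ E := fun hu => h.not_exterior_both_sides hq hq' hu hd
    (pixelAdj_four_iff.2 (by simp)) (pixelAdj_four_iff.2 (by simp)) (Or.inl rfl) (Or.inl rfl)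
  by_contra huN
  have hl : (x - 1, y) ∈ E :=
    (h.swap.four_side_exterior (x := y) (y := x) hq (show (x, y + 1) ∈ middle E N from ⟨hu, huN⟩)).elim
      (fun h' => absurd h'.1 hq'.1) fun h' => h'.1
  obtain ⟨n, hn, hqn⟩ := h.exists_interior _ hq
  have h1 : n ≠ (x, y - 1) := fun e => h.disjoint _ hd (e ▸ hn)
  have h2 : n ≠ (x - 1, y) := fun e => h.disjoint _ hl (e ▸ hn)
  have h3 : n ≠ (x, y + 1) := fun e => huN (e ▸ hn)
  have h4 : n ≠ (x + 1, y) := fun e => hq'.2 (e ▸ hn)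
  rw [pixelAdj_four_iff] at hqn
  obtain ⟨a, b⟩ := n
  simp only [ne_eq, Prod.mk.injEq] at *
  omega

theorem four_interior_above_right (h : Separation .four E N) (hq : (x, y) ∈ middle E N)
    (hq' : (x + 1, y) ∈ middle E N) (hd : (x + 1, y - 1) ∈ E) : (x + 1, y + 1) ∈ N := by
  have := h.reflect_fst.four_interior_above (x := -(x + 1)) (y := y)
    (show (_, _) ∈ middle E N by simpa using hq') (show (_, _) ∈ middle E N by simpa using hq)
    (by simpa using hd)
  simpa using this

theorem four_edge_of_exterior_below (h : Separation .four E N) (hq : (x, y) ∈ middle E N)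
    (hq' : (x + 1, y) ∈ middle E N) (hd : (x, y - 1) ∈ E ∧ (x + 1, y - 1) ∈ E) :
    (x, y + 1) ∈ N ∧ (x + 1, y + 1) ∈ N :=
  ⟨h.four_interior_above hq hq' hd.1, h.four_interior_above_right hq hq' hd.2⟩

/-- Case `α = 4`: one side of an edge of the boundary is interior, the other one exterior. -/
theorem four_edge (h : Separation .four E N) (hq : (x, y) ∈ middle E N)
    (hq' : (x + 1, y) ∈ middle E N) :
    (((x, y + 1) ∈ N ∧ (x + 1, y + 1) ∈ N) ∧ ((x, y - 1) ∈ E ∧ (x + 1, y - 1) ∈ E)) ∨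
      (((x, y + 1) ∈ E ∧ (x + 1, y + 1) ∈ E) ∧ ((x, y - 1) ∈ N ∧ (x + 1, y - 1) ∈ N)) := by
  rcases h.four_side_exterior hq hq' with hu | hd
  · refine Or.inr ⟨hu, ?_⟩
    have := h.reflect_snd.four_edge_of_exterior_below (x := x) (y := -y)
      (show (_, _) ∈ middle E N by simpa using hq) (show (_, _) ∈ middle E N by simpa using hq')
      (by simpa [add_comm] using hu)
    simpa [← sub_eq_neg_add] using this
  · exact Or.inl ⟨h.four_edge_of_exterior_below hq hq' hd, hd⟩

/-- Case `α = 4`: of the two other corners of a cell with a diagonal of the boundary, one is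
interior and the other one exterior. -/
theorem four_diag (h : Separation .four E N) (hq : (x, y) ∈ middle E N)
    (hq' : (x + 1, y + 1) ∈ middle E N) :
    ((x, y + 1) ∈ E ∧ (x + 1, y) ∈ N) ∨ ((x, y + 1) ∈ N ∧ (x + 1, y) ∈ E) := by
  have h1 := h.four_diag_exterior hq hq'
  have h2 := h.four_diag_interior hq hq'
  by_cases hu : (x, y + 1) ∈ E
  · refine Or.inl ⟨hu, ?_⟩
    by_contra hv
    -- If `(x + 1, y)` were on the boundary, the upper side of the edge from `(x, y)` to it would
    -- lie entirely in `N` or in `E`, but it contains the boundary point `(x + 1, y + 1)`.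
    rcases h.four_edge hq ⟨h2 hu, hv⟩ with h' | h'
    · exact hq'.2 h'.1.2
    · exact hq'.1 h'.1.2
  · have hv := h1.resolve_left hu
    refine Or.inr ⟨?_, hv⟩
    by_contra hu'
    rcases h.four_edge ⟨hu, hu'⟩ hq' with h' | h'
    · exact hq.1 (by simpa using h'.2.1)
    · exact hq.2 (by simpa using h'.2.1)

theorem four_antidiag (h : Separation .four E N) (hq : (x + 1, y) ∈ middle E N)
    (hq' : (x, y + 1) ∈ middle E N) :
    ((x + 1, y + 1) ∈ E ∧ (x, y) ∈ N) ∨ ((x + 1, y + 1) ∈ N ∧ (x, y) ∈ E) := by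
  have := h.reflect_fst.four_diag (x := -(x + 1)) (y := y)
    (show (_, _) ∈ middle E N by simpa using hq) (show (_, _) ∈ middle E N by simpa using hq')
  simpa using this

theorem eight_not_adj (h : Separation .eight E N) {n e : Pixel} (hn : n ∈ N) (he : e ∈ E) :
    e.1 + 1 < n.1 ∨ n.1 + 1 < e.1 ∨ e.2 + 1 < n.2 ∨ n.2 + 1 < e.2 := by
  have h1 := h.not_adj n hn e he
  have h2 : n ≠ e := fun e' => h.disjoint _ he (e' ▸ hn)
  rw [pixelAdj_eight_iff] at h1
  rw [ne_eq, Prod.ext_iff] at h2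
  omega

/-- Here `(a, b)` is an interior neighbour of the lower left corner of a cell, outside the cell,
while `(u, y - 1)` and `(x - 1, v)` are exterior pixels below and to the left. Keeping distance 2
from both forces `(a, b)` to be the diagonal pixel `(x - 1, y - 1)`, and thereby `u` to be the far
column. -/
theorem corner_of_far {x y a b u v : ℤ} (h : a ≤ x + 1 ∧ x ≤ a + 1 ∧ b ≤ y + 1 ∧ y ≤ b + 1)
    (h00 : ¬ (a = x ∧ b = y)) (h10 : ¬ (a = x + 1 ∧ b = y)) (h01 : ¬ (a = x ∧ b = y + 1))
    (h11 : ¬ (a = x + 1 ∧ b = y + 1)) (hu : u = x ∨ u = x + 1) (hv : v = y ∨ v = y + 1)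
    (hnu : u + 1 < a ∨ a + 1 < u ∨ y - 1 + 1 < b ∨ b + 1 < y - 1)
    (hnv : x - 1 + 1 < a ∨ a + 1 < x - 1 ∨ v + 1 < b ∨ b + 1 < v) : u = x + 1 := by
  have ha : a = x - 1 := by
    by_contra
    have hb : b = y - 1 := by
      clear hnu hnv
      omega
    omega
  have hb : b = y - 1 := by omega
  omega

theorem corner_of_far_right {x y a b u v : ℤ}
    (h : a ≤ x + 1 + 1 ∧ x + 1 ≤ a + 1 ∧ b ≤ y + 1 ∧ y ≤ b + 1)
    (h00 : ¬ (a = x ∧ b = y)) (h10 : ¬ (a = x + 1 ∧ b = y)) (h01 : ¬ (a = x ∧ b = y + 1))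
    (h11 : ¬ (a = x + 1 ∧ b = y + 1)) (hu : u = x ∨ u = x + 1) (hv : v = y ∨ v = y + 1)
    (hnu : u + 1 < a ∨ a + 1 < u ∨ y - 1 + 1 < b ∨ b + 1 < y - 1)
    (hnv : x + 1 + 1 + 1 < a ∨ a + 1 < x + 1 + 1 ∨ v + 1 < b ∨ b + 1 < v) : u = x := by
  have ha : a = x + 2 := by
    by_contra
    have hb : b = y - 1 := by
      clear hnu hnv
      omega
    omega
  have hb : b = y - 1 := by omega
  omega

/-- Case `α = 8`: no cell has all its corners on the boundary. -/
theorem eight_cell (h : Separation .eight E N) (h00 : (x, y) ∈ middle E N)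
    (h10 : (x + 1, y) ∈ middle E N) (h01 : (x, y + 1) ∈ middle E N)
    (h11 : (x + 1, y + 1) ∈ middle E N) : False := by
  have hb : (x, y - 1) ∈ E ∨ (x + 1, y - 1) ∈ E :=
    (h.eight_side_exterior h00 h10).resolve_left (not_or.2 ⟨h01.1, h11.1⟩)
  have hl : (x - 1, y) ∈ E ∨ (x - 1, y + 1) ∈ E :=
    (h.swap.eight_side_exterior (x := y) (y := x) h00 h01).resolve_left (not_or.2 ⟨h10.1, h11.1⟩)
  have hr : (x + 1 + 1, y) ∈ E ∨ (x + 1 + 1, y + 1) ∈ E :=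
    (h.swap.eight_side_exterior (x := y) (y := x + 1) h10 h11).resolve_right
      (not_or.2 ⟨by simpa using h00.1, by simpa using h01.1⟩)
  have key : ∀ q ∈ middle E N, ∃ n ∈ N, PixelAdj .eight q n ∧ n ≠ (x, y) ∧ n ≠ (x + 1, y) ∧
      n ≠ (x, y + 1) ∧ n ≠ (x + 1, y + 1) := fun q hq => by
    obtain ⟨n, hn, hqn⟩ := h.exists_interior _ hq
    exact ⟨n, hn, hqn, fun e => h00.2 (e ▸ hn), fun e => h10.2 (e ▸ hn), fun e => h01.2 (e ▸ hn),
      fun e => h11.2 (e ▸ hn)⟩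
  obtain ⟨⟨a, b⟩, hn, hqn, ha1, ha2, ha3, ha4⟩ := key _ h00
  obtain ⟨⟨c, d⟩, hn', hqn', hc1, hc2, hc3, hc4⟩ := key _ h10
  have eb : ∃ u, (u = x ∨ u = x + 1) ∧ (u, y - 1) ∈ E := by
    rcases hb with hb | hb <;> exact ⟨_, by simp, hb⟩
  have el : ∃ v, (v = y ∨ v = y + 1) ∧ (x - 1, v) ∈ E := by
    rcases hl with hb | hb <;> exact ⟨_, by simp, hb⟩
  have er : ∃ v, (v = y ∨ v = y + 1) ∧ (x + 1 + 1, v) ∈ E := by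
    rcases hr with hb | hb <;> exact ⟨_, by simp, hb⟩
  obtain ⟨u, hu, hub⟩ := eb
  obtain ⟨v, hv, hvl⟩ := el
  obtain ⟨w, hw, hwr⟩ := er
  have b1 := h.eight_not_adj hn hub
  have b2 := h.eight_not_adj hn hvl
  have b3 := h.eight_not_adj hn' hub
  have b4 := h.eight_not_adj hn' hwr
  rw [pixelAdj_eight_iff] at hqn hqn'
  simp only [ne_eq, Prod.mk.injEq] at b1 b2 b3 b4 hqn hqn' ha1 ha2 ha3 ha4 hc1 hc2 hc3 hc4
  -- The two lower corners of the cell make contradictory demands on the exterior pixel below it.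
  have hu1 := corner_of_far ⟨hqn.2.2.1, hqn.2.1, hqn.2.2.2.2, hqn.2.2.2.1⟩ ha1 ha2 ha3 ha4 hu hv
    b1 b2
  have hu2 := corner_of_far_right ⟨hqn'.2.2.1, hqn'.2.1, hqn'.2.2.2.2, hqn'.2.2.2.1⟩ hc1 hc2 hc3
    hc4 hu hw b3 b4
  rw [hu1] at hu2
  exact absurd hu2 (by simp)

/-- The lower side contains no exterior pixel, by `not_exterior_both_sides`. If it had none in `N`
either, it would form with the edge a cell of boundary points. -/
theorem eight_edge_of_exterior_above (h : Separation .eight E N) (hq : (x, y) ∈ middle E N)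
    (hq' : (x + 1, y) ∈ middle E N) (hu : (x, y + 1) ∈ E ∨ (x + 1, y + 1) ∈ E) :
    (x, y - 1) ∈ N ∨ (x + 1, y - 1) ∈ N := by
  have hadj : ∀ a b : ℤ, (a = x ∨ a = x + 1) → (b = y + 1 ∨ b = y - 1) →
      PixelAdj .eight (x, y) (a, b) := fun a b ha hb => pixelAdj_eight_iff.2 (by simp only; omega)
  have hd : ∀ a, (a = x ∨ a = x + 1) → (a, y - 1) ∉ E := fun a ha hE => by
    have ha' : (a, y - 1) = (x, y - 1) ∨ (a, y - 1) = (x + 1, y - 1) := by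
      rcases ha with rfl | rfl <;> simp
    rcases hu with hu | hu
    · exact h.not_exterior_both_sides hq hq' hu hE (hadj _ _ (by simp) (by simp))
        (hadj _ _ ha (by simp)) (by simp) ha'
    · exact h.not_exterior_both_sides hq hq' hu hE (hadj _ _ (by simp) (by simp))
        (hadj _ _ ha (by simp)) (by simp) ha'
  by_contra hcon
  rw [not_or] at hcon
  exact h.eight_cell (x := x) (y := y - 1) ⟨hd _ (by simp), hcon.1⟩ ⟨hd _ (by simp), hcon.2⟩
    (by simpa using hq) (by simpa using hq')

/-- Case `α = 8`: one side of an edge of the boundary meets the interior, the other one the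
exterior. -/
theorem eight_edge (h : Separation .eight E N) (hq : (x, y) ∈ middle E N)
    (hq' : (x + 1, y) ∈ middle E N) :
    (((x, y + 1) ∈ E ∨ (x + 1, y + 1) ∈ E) ∧ ((x, y - 1) ∈ N ∨ (x + 1, y - 1) ∈ N)) ∨
      (((x, y + 1) ∈ N ∨ (x + 1, y + 1) ∈ N) ∧ ((x, y - 1) ∈ E ∨ (x + 1, y - 1) ∈ E)) := by
  rcases h.eight_side_exterior hq hq' with hu | hd
  · exact Or.inl ⟨hu, h.eight_edge_of_exterior_above hq hq' hu⟩
  · refine Or.inr ⟨?_, hd⟩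
    have := h.reflect_snd.eight_edge_of_exterior_above (x := x) (y := -y)
      (show (_, _) ∈ middle E N by simpa using hq) (show (_, _) ∈ middle E N by simpa using hq')
      (by simpa [← sub_eq_neg_add] using hd)
    simpa [add_comm] using this

theorem exterior_iff_of_adj (h : Separation α E N) {a b : Pixel} (hab : PixelAdj α a b)
    (ha : a ∉ middle E N) (hb : b ∉ middle E N) : a ∈ E ↔ b ∈ E := by
  have h1 := h.not_adj a
  have h2 := h.not_adj b
  have ha' : a ∈ E ∨ a ∈ N := by by_contra hc; exact ha (not_or.1 hc)
  have hb' : b ∈ E ∨ b ∈ N := by by_contra hc; exact hb (not_or.1 hc)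
  constructor
  · exact fun hE => hb'.resolve_right fun hN => h2 hN a hE hab.symm
  · exact fun hE => ha'.resolve_right fun hN => h1 hN b hE hab

/-- Otherwise the ring of 8-neighbours has no boundary point. Walking around it in 4-steps never
switches between `E` and `N`, yet `(x, y)` has 4-neighbours in both. -/
theorem four_exists_middle_adj (h : Separation .four E N) (hq : (x, y) ∈ middle E N) :
    ∃ q' ∈ middle E N, PixelAdj .eight (x, y) q' := by
  by_contra hcon
  push Not at hcon
  obtain ⟨e, he, hqe⟩ := h.exists_exterior _ hq
  obtain ⟨n, hn, hqn⟩ := h.exists_interior _ hq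
  have hnE : n ∉ E := fun hE => h.disjoint _ hE hn
  have step : ∀ a b : Pixel, PixelAdj .eight (x, y) a → PixelAdj .eight (x, y) b →
      PixelAdj .four a b → (a ∈ E ↔ b ∈ E) := fun a b ha hb hab =>
    h.exterior_iff_of_adj hab (fun hm => hcon _ hm ha) (fun hm => hcon _ hm hb)
  have s1 := step (x + 1, y) (x + 1, y + 1) (by simp [pixelAdj_eight_iff]; omega)
    (by simp [pixelAdj_eight_iff]; omega) (by simp [pixelAdj_four_iff])
  have s2 := step (x + 1, y + 1) (x, y + 1) (by simp [pixelAdj_eight_iff]; omega)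
    (by simp [pixelAdj_eight_iff]; omega) (by simp [pixelAdj_four_iff])
  have s3 := step (x, y + 1) (x - 1, y + 1) (by simp [pixelAdj_eight_iff]; omega)
    (by simp [pixelAdj_eight_iff]; omega) (by simp [pixelAdj_four_iff])
  have s4 := step (x - 1, y + 1) (x - 1, y) (by simp [pixelAdj_eight_iff]; omega)
    (by simp [pixelAdj_eight_iff]; omega) (by simp [pixelAdj_four_iff])
  have s5 := step (x - 1, y) (x - 1, y - 1) (by simp [pixelAdj_eight_iff]; omega)
    (by simp [pixelAdj_eight_iff]; omega) (by simp [pixelAdj_four_iff])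
  have s6 := step (x - 1, y - 1) (x, y - 1) (by simp [pixelAdj_eight_iff]; omega)
    (by simp [pixelAdj_eight_iff]; omega) (by simp [pixelAdj_four_iff])
  have key : ∀ z, PixelAdj .four (x, y) z → ((x + 1, y) ∈ E ↔ z ∈ E) := by
    rintro ⟨a, b⟩ hz
    rw [pixelAdj_four_iff] at hz
    simp only at hz
    have : (a = x + 1 ∧ b = y) ∨ (a = x ∧ b = y + 1) ∨ (a = x - 1 ∧ b = y) ∨
      (a = x ∧ b = y - 1) := by omega
    rcases this with ⟨rfl, rfl⟩ | ⟨rfl, rfl⟩ | ⟨rfl, rfl⟩ | ⟨rfl, rfl⟩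
    · rfl
    · exact s1.trans s2
    · exact s1.trans (s2.trans (s3.trans s4))
    · exact s1.trans (s2.trans (s3.trans (s4.trans (s5.trans s6))))
  exact hnE ((key n hqn).1 ((key e hqe).2 he))

/-- Every point of the boundary has a `β`-adjacent point on the boundary. -/
theorem exists_middle_adj (h : Separation α E N) {q : Pixel} (hq : q ∈ middle E N) :
    ∃ q' ∈ middle E N, PixelAdj α.dual q q' := by
  obtain ⟨x, y⟩ := q
  cases α with
  | four => exact h.four_exists_middle_adj hq
  | eight =>
    by_contra hcon
    push Not at hcon
    obtain ⟨e, he, hqe⟩ := h.exists_exterior _ hq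
    obtain ⟨n, hn, hqn⟩ := h.exists_interior _ hq
    have hnE : n ∉ E := fun hE => h.disjoint _ hE hn
    have hnm : ∀ a b : ℤ, PixelAdj .four (x, y) (a, b) → (a, b) ∉ middle E N :=
      fun a b hab hm => hcon _ hm hab
    -- The 4-neighbours are off the boundary and linked by diagonal steps, and every diagonal
    -- neighbour off the boundary is adjacent to one of them. So all these pixels lie on the same
    -- side.
    have key : ∀ z ∉ middle E N, PixelAdj .eight (x, y) z → (z ∈ E ↔ (x, y + 1) ∈ E) := by
      rintro ⟨a, b⟩ hzm hz
      rw [pixelAdj_eight_iff] at hz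
      simp only at hz
      have hr : ∀ c : ℤ, (c = x - 1 ∨ c = x + 1) → ((c, y) ∈ E ↔ (x, y + 1) ∈ E) := fun c hc =>
        h.exterior_iff_of_adj (pixelAdj_eight_iff.2 (by simp only; omega))
          (hnm _ _ (pixelAdj_four_iff.2 (Or.inr ⟨rfl, by simp only; omega⟩)))
          (hnm _ _ (pixelAdj_four_iff.2 (Or.inl ⟨rfl, Or.inr rfl⟩)))
      have hz' : ∀ c : ℤ, (c = x - 1 ∨ c = x + 1) → (a ≠ c ∨ b ≠ y) → a ≤ c + 1 → c ≤ a + 1 →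
          ((a, b) ∈ E ↔ (c, y) ∈ E) := fun c hc h1 h2 h3 =>
        h.exterior_iff_of_adj (pixelAdj_eight_iff.2 (by simp only; omega)) hzm
          (hnm _ _ (pixelAdj_four_iff.2 (Or.inr ⟨rfl, by simp only; omega⟩)))
      by_cases hax : a = x - 1
      · by_cases hby : b = y
        · rw [hax, hby]
          exact hr _ (Or.inl rfl)
        · exact (hz' (x - 1) (Or.inl rfl) (Or.inr hby) (by omega) (by omega)).trans
            (hr _ (Or.inl rfl))
      · by_cases hby : a = x + 1 ∧ b = y
        · rw [hby.1, hby.2]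
          exact hr _ (Or.inr rfl)
        · exact (hz' (x + 1) (Or.inr rfl) (by omega) (by omega) (by omega)).trans
            (hr _ (Or.inr rfl))
    exact hnE ((key n (fun hm => hm.2 hn) hqn).2 ((key e (fun hm => hm.1 he) hqe).1 he))

end Separation
end DigitalImage

/-! ### The exterior of a component defines a separation -/

namespace DigitalImage

open Relation

variable {α : Connectivity} {T : Set Pixel}

theorem charGraph_adj {x y : Pixel} : (charGraph α T).Adj x y ↔
    (x ∉ sitePerimeter α T ∧ y ∉ sitePerimeter α T ∧ PixelAdj α x y) ∨
      (x ∈ sitePerimeter α T ∧ y ∈ sitePerimeter α T ∧ PixelAdj α.dual x y) := by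
  have hw : ∀ z, blackImage (sitePerimeter α T) z = .white ↔ z ∉ sitePerimeter α T := fun z => by
    unfold blackImage
    split_ifs with h <;> simp [h]
  have hb : ∀ z, blackImage (sitePerimeter α T) z = .black ↔ z ∈ sitePerimeter α T := fun z => by
    unfold blackImage
    split_ifs with h <;> simp [h]
  simp only [charGraph, Image.graph, hw, hb]

theorem notMem_sitePerimeter_of_mem {t : Pixel} (ht : t ∈ T) : t ∉ sitePerimeter α T :=
  fun h => h.1 ht

theorem exists_sitePerimeter_subset_Icc (hT : T.Finite) :
    ∃ l u : Pixel, sitePerimeter α T ⊆ Set.Icc l u := by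
  obtain ⟨u, hu⟩ := hT.bddAbove
  obtain ⟨l, hl⟩ := hT.bddBelow
  refine ⟨(l.1 - 1, l.2 - 1), (u.1 + 1, u.2 + 1), ?_⟩
  rintro z ⟨-, t, ht, hzt⟩
  have h1 := hu ht
  have h2 := hl ht
  have h3 := pixelAdj_eight_iff.1 hzt.eight
  simp only [Prod.le_def, Set.mem_Icc] at *
  omega

theorem reachable_of_forall_int {G : SimpleGraph Pixel} {f : ℤ → Pixel}
    (h : ∀ a, G.Adj (f a) (f (a + 1))) (a b : ℤ) : G.Reachable (f a) (f b) := by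
  have key : ∀ a, G.Reachable (f 0) (f a) := fun a => by
    induction a using Int.induction_on with
    | zero => rfl
    | succ i ih => exact ih.trans (h _).reachable
    | pred i ih => exact ih.trans (by simpa using (h (-i - 1)).reachable.symm)
  exact (key a).symm.trans (key b)

/-- Outside the box a whole row or a whole column avoids the perimeter and meets a row or column
beyond the box, so everything there belongs to one component. -/
theorem reachable_corner {l u : Pixel} (hP : sitePerimeter α T ⊆ Set.Icc l u) {z : Pixel}
    (hz : z ∉ Set.Icc l u) : (charGraph α T).Reachable z (u.1 + 1, u.2 + 1) := by
  have hcol : ∀ c, (∀ y, (c, y) ∉ Set.Icc l u) → ∀ y y', (charGraph α T).Reachable (c, y) (c, y') :=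
    fun c hc => reachable_of_forall_int fun y => charGraph_adj.2 <| Or.inl
      ⟨fun h => hc _ (hP h), fun h => hc _ (hP h), PixelAdj.of_four (pixelAdj_four_iff.2 (by simp))⟩
  have hrow : ∀ c, (∀ x, (x, c) ∉ Set.Icc l u) → ∀ x x', (charGraph α T).Reachable (x, c) (x', c) :=
    fun c hc => reachable_of_forall_int (f := fun x => (x, c)) fun y => charGraph_adj.2 <| Or.inl
      ⟨fun h => hc _ (hP h), fun h => hc _ (hP h), PixelAdj.of_four (pixelAdj_four_iff.2 (by simp))⟩
  have hcol' : ∀ c, c < l.1 ∨ u.1 < c → ∀ y, (c, y) ∉ Set.Icc l u := fun c hc y hy => by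
    simp only [Set.mem_Icc, Prod.le_def] at hy
    omega
  have hrow' : ∀ c, c < l.2 ∨ u.2 < c → ∀ x, (x, c) ∉ Set.Icc l u := fun c hc y hy => by
    simp only [Set.mem_Icc, Prod.le_def] at hy
    omega
  obtain ⟨a, b⟩ := z
  have : (a < l.1 ∨ u.1 < a) ∨ (b < l.2 ∨ u.2 < b) := by
    simp only [Set.mem_Icc, Prod.le_def] at hz
    omega
  rcases this with h | h
  · exact (hcol a (hcol' a h) b (u.2 + 1)).trans (hrow _ (hrow' _ (by omega)) _ _)
  · exact (hrow b (hrow' b h) a (u.1 + 1)).trans (hcol _ (hcol' _ (by omega)) _ _)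

theorem mem_exterior_of_notMem_Icc {l u : Pixel} (hP : sitePerimeter α T ⊆ Set.Icc l u) {z : Pixel}
    (hz : z ∉ Set.Icc l u) : z ∈ exterior α T := by
  refine ((Set.finite_Icc l u).infinite_compl).mono fun w hw => ?_
  rw [SimpleGraph.ConnectedComponent.mem_supp_iff, SimpleGraph.ConnectedComponent.eq]
  exact (reachable_corner hP hw).trans (reachable_corner hP hz).symm

theorem exterior_reachable_corner {l u : Pixel} (hP : sitePerimeter α T ⊆ Set.Icc l u) {e : Pixel}
    (he : e ∈ exterior α T) : (charGraph α T).Reachable e (u.1 + 1, u.2 + 1) := by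
  obtain ⟨z, hz, hzB⟩ := he.exists_notMem_finite (Set.finite_Icc l u)
  rw [SimpleGraph.ConnectedComponent.mem_supp_iff, SimpleGraph.ConnectedComponent.eq] at hz
  exact hz.symm.trans (reachable_corner hP hzB)

theorem mem_exterior_of_reachable {e z : Pixel} (he : e ∈ exterior α T)
    (h : (charGraph α T).Reachable e z) : z ∈ exterior α T := by
  have : (charGraph α T).connectedComponentMk z = (charGraph α T).connectedComponentMk e :=
    SimpleGraph.ConnectedComponent.eq.2 h.symm
  rw [exterior, Set.mem_ofPred_eq, this]
  exact he

theorem notMem_exterior_of_reachable_subset {S : Set Pixel} (hS : S.Finite) {p : Pixel}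
    (h : ∀ a ∈ S, ∀ b, (charGraph α T).Adj a b → b ∈ S) (hp : p ∈ S) : p ∉ exterior α T := by
  intro he
  refine he (hS.subset fun z hz => ?_)
  rw [SimpleGraph.ConnectedComponent.mem_supp_iff, SimpleGraph.ConnectedComponent.eq,
    SimpleGraph.reachable_comm, SimpleGraph.reachable_iff_reflTransGen] at hz
  induction hz with
  | refl => exact hp
  | tail _ hbc ih => exact h _ ih _ hbc

theorem sitePerimeter_finite (hT : T.Finite) : (sitePerimeter α T).Finite := by
  obtain ⟨l, u, hP⟩ := exists_sitePerimeter_subset_Icc (α := α) hT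
  exact (Set.finite_Icc l u).subset hP

theorem notMem_exterior_of_mem_sitePerimeter (hT : T.Finite) {p : Pixel}
    (hp : p ∈ sitePerimeter α T) : p ∉ exterior α T :=
  notMem_exterior_of_reachable_subset (sitePerimeter_finite hT)
    (fun _ ha _ hab => (charGraph_adj.1 hab).elim (fun h => absurd ha h.1) fun h => h.2.1) hp

theorem notMem_exterior_of_mem (hT : T.Finite) {t : Pixel} (ht : t ∈ T) : t ∉ exterior α T :=
  notMem_exterior_of_reachable_subset hT
    (fun a ha _ hab => (charGraph_adj.1 hab).elim
      (fun h => by_contra fun hb => h.2.1 ⟨hb, a, ha, h.2.2.symm⟩)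
      fun h => absurd h.1 (notMem_sitePerimeter_of_mem ha)) ht

theorem exterior_compl_finite (hT : T.Finite) : (exterior α T)ᶜ.Finite := by
  obtain ⟨l, u, hP⟩ := exists_sitePerimeter_subset_Icc (α := α) hT
  exact (Set.finite_Icc l u).subset fun z hz =>
    by_contra fun h => hz (mem_exterior_of_notMem_Icc hP h)

/-- The pixels that are neither in the exterior nor on the exterior perimeter. -/
def inner (α : Connectivity) (T : Set Pixel) : Set Pixel := (exterior α T ∪ extPerimeter α T)ᶜ

theorem middle_inner (hT : T.Finite) : middle (exterior α T) (inner α T) = extPerimeter α T := by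
  ext q
  simp only [middle, inner, Set.mem_ofPred_eq, Set.mem_compl_iff, Set.mem_union, not_or, not_and,
    not_not]
  exact ⟨fun h => h.2 h.1, fun h => ⟨notMem_exterior_of_mem_sitePerimeter hT h.1, fun _ => h⟩⟩

theorem subset_inner (hT : T.Finite) : T ⊆ inner α T := fun _ ht h =>
  h.elim (notMem_exterior_of_mem hT ht) fun h => notMem_sitePerimeter_of_mem ht h.1

theorem mem_inner_of_notMem_sitePerimeter {z : Pixel} (hP : z ∉ sitePerimeter α T)
    (hE : z ∉ exterior α T) : z ∈ inner α T := fun h => h.elim hE fun h => hP h.1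

theorem exterior_connected (hT : T.Finite) {e e' : Pixel} (he : e ∈ exterior α T)
    (he' : e' ∈ exterior α T) :
    ReflTransGen (fun a b => a ∈ exterior α T ∧ b ∈ exterior α T ∧ PixelAdj α a b) e e' := by
  obtain ⟨l, u, hP⟩ := exists_sitePerimeter_subset_Icc (α := α) hT
  have h := (exterior_reachable_corner hP he).trans (exterior_reachable_corner hP he').symm
  rw [SimpleGraph.reachable_iff_reflTransGen] at h
  clear he'
  induction h with
  | refl => rfl
  | @tail b c hab hbc ih =>
    have hb : b ∈ exterior α T := mem_exterior_of_reachable he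
      ((SimpleGraph.reachable_iff_reflTransGen _ _).2 hab)
    refine ih.tail ⟨hb, mem_exterior_of_reachable hb hbc.reachable, ?_⟩
    exact (charGraph_adj.1 hbc).elim (fun h => h.2.2)
      fun h => absurd hb (notMem_exterior_of_mem_sitePerimeter hT h.1)

theorem IsComponent.reflTransGen (hT : IsComponent α T) {t t' : Pixel} (ht : t ∈ T) (ht' : t' ∈ T) :
    ReflTransGen (fun a b => a ∈ T ∧ b ∈ T ∧ PixelAdj α a b) t t' := by
  have h := hT.2.preconnected ⟨t, ht⟩ ⟨t', ht'⟩
  rw [SimpleGraph.reachable_iff_reflTransGen] at h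
  exact h.lift (p := fun a b => a ∈ T ∧ b ∈ T ∧ PixelAdj α a b) Subtype.val
    fun a b hab => ⟨a.2, b.2, hab⟩

/-- A finite nonempty set of pixels has a pixel with a neighbour outside, different from two given
ones. -/
theorem exists_adj_notMem_ne {F : Set Pixel} (hF : F.Finite) (hne : F.Nonempty) (q q' : Pixel) :
    ∃ f ∈ F, ∃ p ∉ F, PixelAdj .four f p ∧ p ≠ q ∧ p ≠ q' := by
  -- The pixels to the right of a rightmost point, to the left of a leftmost one and above a topmost
  -- one are three distinct pixels, so one of them is neither `q` nor `q'`.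
  obtain ⟨a, ha, hamax⟩ := Set.exists_max_image F (fun z => z.1) hF hne
  obtain ⟨b, hb, hbmin⟩ := Set.exists_min_image F (fun z => z.1) hF hne
  obtain ⟨c, hc, hcmax⟩ := Set.exists_max_image F (fun z => z.2) hF hne
  have h1 : (a.1 + 1, a.2) ∉ F := fun h => by have := hamax _ h; simp at this
  have h2 : (b.1 - 1, b.2) ∉ F := fun h => by have := hbmin _ h; simp at this
  have h3 : (c.1, c.2 + 1) ∉ F := fun h => by have := hcmax _ h; simp at this
  have hab := hamax b hb
  have hac := hamax c hc
  have hbc := hbmin c hc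
  by_cases k1 : (a.1 + 1, a.2) ≠ q ∧ (a.1 + 1, a.2) ≠ q'
  · exact ⟨a, ha, _, h1, pixelAdj_four_iff.2 (by simp), k1⟩
  by_cases k2 : (b.1 - 1, b.2) ≠ q ∧ (b.1 - 1, b.2) ≠ q'
  · exact ⟨b, hb, _, h2, pixelAdj_four_iff.2 (by simp), k2⟩
  refine ⟨c, hc, _, h3, pixelAdj_four_iff.2 (by simp), ?_⟩
  simp only [ne_eq, Prod.ext_iff] at *
  omega

/-- The relation of `Separation.compl_connected`. -/
def ComplStep (α : Connectivity) (T : Set Pixel) (q q' a b : Pixel) : Prop :=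
  PixelAdj α a b ∧ (a ∉ exterior α T ∧ a ≠ q ∧ a ≠ q') ∧
    (b ∉ exterior α T ∧ b ≠ q ∧ b ≠ q') ∧ (a ∈ inner α T ∨ b ∈ inner α T)

theorem ComplStep.symm {q q' a b : Pixel} (h : ComplStep α T q q' a b) : ComplStep α T q q' b a :=
  ⟨h.1.symm, h.2.2.1, h.2.1, h.2.2.2.symm⟩

theorem inner_ne {n q : Pixel} (hn : n ∈ inner α T) (hq : q ∈ extPerimeter α T) : n ≠ q :=
  fun h => hn (Or.inr (h ▸ hq))

/-- A perimeter pixel is adjacent to `T` outright. Any other `k` lies in a finite component of the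
characteristic graph; some pixel `p` next to that component differs from `q` and `q'`. It is a
perimeter pixel, as otherwise it would belong to the component, and so it leads on to `T`. -/
theorem exists_reflTransGen_complStep (hT : T.Finite) {q q' : Pixel} (hq : q ∈ extPerimeter α T)
    (hq' : q' ∈ extPerimeter α T) {k : Pixel} (hk : k ∉ exterior α T) (hkq : k ≠ q)
    (hkq' : k ≠ q') : ∃ t ∈ T, ReflTransGen (ComplStep α T q q') k t := by
  have hin : ∀ n ∈ inner α T, n ∉ exterior α T ∧ n ≠ q ∧ n ≠ q' := fun n hn =>
    ⟨fun h => hn (Or.inl h), inner_ne hn hq, inner_ne hn hq'⟩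
  have hper : ∀ p ∈ sitePerimeter α T, p ≠ q → p ≠ q' → ∃ t ∈ T, ComplStep α T q q' p t := by
    intro p hp hpq hpq'
    obtain ⟨t, ht, hpt⟩ := hp.2
    have htN := subset_inner (α := α) hT ht
    exact ⟨t, ht, hpt, ⟨notMem_exterior_of_mem_sitePerimeter hT hp, hpq, hpq'⟩, hin t htN,
      Or.inr htN⟩
  by_cases hkP : k ∈ sitePerimeter α T
  · obtain ⟨t, ht, hkt⟩ := hper k hkP hkq hkq'
    exact ⟨t, ht, .single hkt⟩
  have hkN := mem_inner_of_notMem_sitePerimeter hkP hk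
  let F : Set Pixel := ((charGraph α T).connectedComponentMk k).supp
  have hF : F.Finite := Set.not_infinite.1 hk
  have hkF : k ∈ F := by simp [F, SimpleGraph.ConnectedComponent.mem_supp_iff]
  have hFk : ∀ f ∈ F, f ∈ inner α T ∧ f ∉ sitePerimeter α T ∧
      ReflTransGen (ComplStep α T q q') k f := by
    intro f hf
    have hf' : (charGraph α T).Reachable k f := by
      rw [SimpleGraph.ConnectedComponent.mem_supp_iff, SimpleGraph.ConnectedComponent.eq] at hf
      exact hf.symm
    rw [SimpleGraph.reachable_iff_reflTransGen] at hf'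
    clear hf
    induction hf' with
    | refl => exact ⟨hkN, hkP, .refl⟩
    | @tail b c _ hbc ih =>
      obtain ⟨hb, hbP, hkb⟩ := ih
      rcases charGraph_adj.1 hbc with ⟨-, hcP, hadj⟩ | ⟨hbP', -, -⟩
      · have hcE : c ∉ exterior α T := fun hc =>
          hb (Or.inl (mem_exterior_of_reachable hc hbc.symm.reachable))
        have hcN := mem_inner_of_notMem_sitePerimeter hcP hcE
        exact ⟨hcN, hcP, hkb.tail ⟨hadj, hin b hb, hin c hcN, Or.inl hb⟩⟩
      · exact absurd hbP' hbP
  obtain ⟨f, hf, p, hp, hfp, hpq, hpq'⟩ := exists_adj_notMem_ne hF ⟨k, hkF⟩ q q'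
  obtain ⟨hfN, hfP, hkf⟩ := hFk f hf
  have hpP : p ∈ sitePerimeter α T := by
    by_contra hpP
    refine hp ((SimpleGraph.ConnectedComponent.mem_supp_congr_adj _ ?_).1 hf)
    exact charGraph_adj.2 (Or.inl ⟨hfP, hpP, hfp.of_four⟩)
  obtain ⟨t, ht, hpt⟩ := hper p hpP hpq hpq'
  exact ⟨t, ht, (hkf.tail ⟨hfp.of_four, hin f hfN, hpt.2.1, Or.inl hfN⟩).tail hpt⟩

/-- Connectedness of the punctured complement of the exterior is obtained by passing through `T`,
which is α-connected and contains neither deleted point. -/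
theorem separation (hT : IsComponent α T) : Separation α (exterior α T) (inner α T) := by
  have hfin := hT.1
  refine ⟨fun z hz hn => hn (Or.inl hz), fun n hn e he hne => ?_, fun q hq => ?_, fun q hq => ?_,
    fun e he e' he' => exterior_connected hfin he he',
    fun q hq q' hq' k hk hkq hkq' k' hk' hkq2 hkq2' => ?_⟩
  · by_cases hP : n ∈ sitePerimeter α T
    · exact hn (Or.inr ⟨hP, e, he, hne⟩)
    · refine hn (Or.inl (mem_exterior_of_reachable he (SimpleGraph.Adj.reachable ?_)))
      exact charGraph_adj.2 (Or.inl
        ⟨fun h => notMem_exterior_of_mem_sitePerimeter hfin h he, hP, hne.symm⟩)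
  · rw [middle_inner hfin] at hq
    exact hq.2
  · rw [middle_inner hfin] at hq
    obtain ⟨t, ht, hqt⟩ := hq.1.2
    exact ⟨t, subset_inner hfin ht, hqt⟩
  · rw [middle_inner hfin] at hq hq'
    obtain ⟨t, ht, hkt⟩ := exists_reflTransGen_complStep hfin hq hq' hk hkq hkq'
    obtain ⟨t', ht', hkt'⟩ := exists_reflTransGen_complStep hfin hq hq' hk' hkq2 hkq2'
    have hsymm : ReflTransGen (ComplStep α T q q') t' k' :=
      hkt'.swap.lift id fun _ _ h => h.symm
    have hin : ∀ t ∈ T, t ∈ inner α T ∧ t ∉ exterior α T ∧ t ≠ q ∧ t ≠ q' := fun t ht =>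
      have h := subset_inner hfin ht
      ⟨h, fun h' => h (Or.inl h'), inner_ne h hq, inner_ne h hq'⟩
    have htt' : ReflTransGen (ComplStep α T q q') t t' :=
      (hT.reflTransGen ht ht').lift id fun a b hab =>
        ⟨hab.2.2, (hin a hab.1).2, (hin b hab.2.1).2, Or.inl (hin a hab.1).1⟩
    exact (hkt.trans htt').trans hsymm

theorem extPerimeter_adj_iff {u v : Pixel} (hu : u ∈ extPerimeter α T) (hv : v ∈ extPerimeter α T) :
    (charGraph α T).Adj u v ↔ PixelAdj α.dual u v := by
  rw [charGraph_adj]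
  have := hu.1
  have := hv.1
  tauto

theorem exterior_infinite (hT : T.Finite) : (exterior α T).Infinite := fun h =>
  Set.infinite_univ ((h.union (exterior_compl_finite (α := α) hT)).subset
    fun _ _ => by simp)

end DigitalImage

/-! ### Points of the plane closer to one set of pixels than to another -/

namespace DigitalImage

variable {α : Connectivity}

theorem gridDist_comm (α : Connectivity) (x y : ℝ × ℝ) : gridDist α x y = gridDist α y x := by
  cases α <;> simp only [gridDist, abs_sub_comm]

theorem gridDist_triangle (α : Connectivity) (x y z : ℝ × ℝ) :
    gridDist α x z ≤ gridDist α x y + gridDist α y z := by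
  have h1 := abs_sub_le x.1 y.1 z.1
  have h2 := abs_sub_le x.2 y.2 z.2
  cases α
  · simp only [gridDist]
    linarith
  · simp only [gridDist]
    refine max_le (h1.trans ?_) (h2.trans ?_) <;> gcongr
    exacts [le_max_left _ _, le_max_left _ _, le_max_right _ _, le_max_right _ _]

theorem abs_fst_le_gridDist (α : Connectivity) (x y : ℝ × ℝ) : |x.1 - y.1| ≤ gridDist α x y := by
  cases α
  · exact le_add_of_nonneg_right (abs_nonneg _)
  · exact le_max_left _ _

theorem abs_snd_le_gridDist (α : Connectivity) (x y : ℝ × ℝ) : |x.2 - y.2| ≤ gridDist α x y := by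
  cases α
  · exact le_add_of_nonneg_left (abs_nonneg _)
  · exact le_max_right _ _

theorem gridDist_le_add (α : Connectivity) (x y : ℝ × ℝ) :
    gridDist α x y ≤ |x.1 - y.1| + |x.2 - y.2| := by
  cases α
  · exact le_rfl
  · exact max_le_add_of_nonneg (abs_nonneg _) (abs_nonneg _)

theorem gridDist_nonneg (α : Connectivity) (x y : ℝ × ℝ) : 0 ≤ gridDist α x y :=
  (abs_nonneg _).trans (abs_fst_le_gridDist α x y)

theorem gridDist_self (α : Connectivity) (x : ℝ × ℝ) : gridDist α x x = 0 := by
  cases α <;> simp [gridDist]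

theorem continuous_gridDist (α : Connectivity) (x : ℝ × ℝ) : Continuous (gridDist α x) := by
  cases α
  · show Continuous fun y : ℝ × ℝ => |x.1 - y.1| + |x.2 - y.2|
    fun_prop
  · show Continuous fun y : ℝ × ℝ => max |x.1 - y.1| |x.2 - y.2|
    fun_prop

/-- A point of a segment splits the distance between the end points. -/
theorem gridDist_add_of_mem_segment (α : Connectivity) {x y z : ℝ × ℝ} (h : y ∈ segment ℝ x z) :
    gridDist α x y + gridDist α y z = gridDist α x z := by
  obtain ⟨s, t, hs, ht, hst, rfl⟩ := h
  obtain rfl : s = 1 - t := by linarith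
  have e1 : ∀ a b : ℝ, |a - ((1 - t) * a + t * b)| = t * |a - b| := fun a b => by
    rw [show a - ((1 - t) * a + t * b) = t * (a - b) by ring, abs_mul, abs_of_nonneg ht]
  have e2 : ∀ a b : ℝ, |(1 - t) * a + t * b - b| = (1 - t) * |a - b| := fun a b => by
    rw [show (1 - t) * a + t * b - b = (1 - t) * (a - b) by ring, abs_mul, abs_of_nonneg hs]
  cases α <;>
    simp only [gridDist, Prod.fst_add, Prod.snd_add, Prod.smul_fst, Prod.smul_snd, smul_eq_mul,
      e1, e2]
  · ring
  · rw [← mul_max_of_nonneg _ _ ht, ← mul_max_of_nonneg _ _ hs]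
    ring

theorem one_le_gridDist {a b : Pixel} (h : a ≠ b) :
    1 ≤ gridDist α (toPlane a) (toPlane b) := by
  have key : ∀ m n : ℤ, m ≠ n → (1 : ℝ) ≤ |(m : ℝ) - n| := fun m n hmn => by
    exact_mod_cast Int.one_le_abs (sub_ne_zero.2 hmn)
  by_cases h1 : a.1 = b.1
  · have h2 : a.2 ≠ b.2 := fun h2 => h (Prod.ext h1 h2)
    exact (key _ _ h2).trans (abs_snd_le_gridDist α (toPlane a) (toPlane b))
  · exact (key _ _ h1).trans (abs_fst_le_gridDist α (toPlane a) (toPlane b))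

theorem two_le_gridDist {a b : Pixel} (h : a ≠ b) (h' : ¬ PixelAdj α a b) :
    2 ≤ gridDist α (toPlane a) (toPlane b) := by
  have h1 := one_le_gridDist (α := α) h
  have hint : ∃ m : ℤ, gridDist α (toPlane a) (toPlane b) = m := by
    cases α
    · exact ⟨|a.1 - b.1| + |a.2 - b.2|, by simp [gridDist, toPlane]⟩
    · exact ⟨max |a.1 - b.1| |a.2 - b.2|, by simp [gridDist, toPlane]⟩
  unfold PixelAdj at h'
  obtain ⟨m, hm⟩ := hint
  rw [hm] at h1 h' ⊢
  norm_cast at h1 h' ⊢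
  omega

/-- Only finitely many pixels lie within a given distance, so infima over nonempty sets are
attained; strict inequality of distances then becomes membership in `closer`. -/
theorem exists_nearest (α : Connectivity) (x : ℝ × ℝ) {S : Set Pixel} (hS : S.Nonempty) :
    ∃ z ∈ S, ∀ w ∈ S, gridDist α x (toPlane z) ≤ gridDist α x (toPlane w) := by
  obtain ⟨z₀, hz₀⟩ := hS
  set r := gridDist α x (toPlane z₀)
  have hfin : {z ∈ S | gridDist α x (toPlane z) ≤ r}.Finite := by
    refine (Set.finite_Icc (⌊x.1 - r⌋, ⌊x.2 - r⌋) (⌈x.1 + r⌉, ⌈x.2 + r⌉)).subset ?_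
    rintro z ⟨-, hz⟩
    have h1 := abs_le.1 ((abs_fst_le_gridDist α x (toPlane z)).trans hz)
    have h2 := abs_le.1 ((abs_snd_le_gridDist α x (toPlane z)).trans hz)
    simp only [toPlane] at h1 h2
    refine ⟨⟨?_, ?_⟩, ⟨?_, ?_⟩⟩
    · exact_mod_cast (Int.floor_le _).trans (by linarith : x.1 - r ≤ z.1)
    · exact_mod_cast (Int.floor_le _).trans (by linarith : x.2 - r ≤ z.2)
    · exact_mod_cast (by linarith : (z.1 : ℝ) ≤ x.1 + r).trans (Int.le_ceil _)
    · exact_mod_cast (by linarith : (z.2 : ℝ) ≤ x.2 + r).trans (Int.le_ceil _)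
  obtain ⟨z, hz, hmin⟩ := Set.exists_min_image _ (fun z => gridDist α x (toPlane z)) hfin
    ⟨z₀, hz₀, le_rfl⟩
  refine ⟨z, hz.1, fun w hw => ?_⟩
  by_cases h : gridDist α x (toPlane w) ≤ r
  · exact hmin w ⟨hw, h⟩
  · exact hz.2.trans (not_le.1 h).le

/-- The points of the plane that are closer to `A` than to `B`. -/
def closer (α : Connectivity) (A B : Set Pixel) : Set (ℝ × ℝ) :=
  {x | ∃ a ∈ A, ∀ b ∈ B, gridDist α x (toPlane a) < gridDist α x (toPlane b)}

theorem distTo_lt_distTo_iff {x : ℝ × ℝ} {A B : Set Pixel} :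
    distTo α x A < distTo α x B ↔ x ∈ closer α A B := by
  constructor
  · intro h
    unfold distTo at h
    simp only [iInf_lt_iff] at h
    obtain ⟨a, ha, hab⟩ := h
    refine ⟨a, ha, fun b hb => ?_⟩
    have := hab.trans_le (iInf₂_le b hb)
    exact lt_of_not_ge fun hle => this.not_ge (ENNReal.ofReal_le_ofReal hle)
  · rintro ⟨a, ha, hab⟩
    have h1 : distTo α x A ≤ ENNReal.ofReal (gridDist α x (toPlane a)) := iInf₂_le a ha
    rcases B.eq_empty_or_nonempty with rfl | hB
    · refine h1.trans_lt ?_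
      simp [distTo]
    · obtain ⟨b, hb, hmin⟩ := exists_nearest α x hB
      refine h1.trans_lt (lt_of_lt_of_le ?_
        (le_iInf₂ fun w hw => ENNReal.ofReal_le_ofReal (hmin w hw)))
      exact (ENNReal.ofReal_lt_ofReal_iff_of_nonneg (gridDist_nonneg _ _ _)).2 (hab b hb)

theorem isOpen_closer (α : Connectivity) (A : Set Pixel) {B : Set Pixel} (hB : B.Nonempty) :
    IsOpen (closer α A B) := by
  rw [isOpen_iff_mem_nhds]
  rintro x ⟨a, ha, hab⟩
  obtain ⟨b, hb, hmin⟩ := exists_nearest α x hB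
  have hδ := hab b hb
  have hnear : ∀ᶠ y in nhds x, gridDist α x y <
      (gridDist α x (toPlane b) - gridDist α x (toPlane a)) / 2 :=
    (continuous_gridDist α x).continuousAt.eventually_lt continuousAt_const
      (by rw [gridDist_self]; linarith)
  filter_upwards [hnear] with y hy
  refine ⟨a, ha, fun w hw => ?_⟩
  have h1 := hmin w hw
  have h2 := gridDist_triangle α x y (toPlane w)
  have h3 := gridDist_triangle α y x (toPlane a)
  rw [gridDist_comm α y x] at h3
  linarith

theorem disjoint_closer (α : Connectivity) (A B : Set Pixel) :
    Disjoint (closer α A B) (closer α B A) := by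
  rw [Set.disjoint_left]
  rintro x ⟨a, ha, hab⟩ ⟨b, hb, hba⟩
  exact lt_asymm (hab b hb) (hba a ha)

/-- Grid distances between pixels are integers, so every point of `B` is at distance at least 2 from
`a`, hence more than 1 from `x`. -/
theorem mem_closer_of_lt_one {A B : Set Pixel} (h : ∀ a ∈ A, a ∉ B)
    (h' : ∀ a ∈ A, ∀ b ∈ B, ¬ PixelAdj α a b) {x : ℝ × ℝ} {a : Pixel} (ha : a ∈ A)
    (hx : gridDist α x (toPlane a) < 1) : x ∈ closer α A B := by
  refine ⟨a, ha, fun b hb => ?_⟩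
  have h1 := two_le_gridDist (fun e : a = b => h a ha (e ▸ hb)) (h' a ha b hb)
  have h2 := gridDist_triangle α (toPlane a) x (toPlane b)
  rw [gridDist_comm α (toPlane a) x] at h2
  linarith

theorem segment_subset_closer {A B : Set Pixel} {x : ℝ × ℝ} {a : Pixel} (ha : a ∈ A)
    (hx : ∀ b ∈ B, gridDist α x (toPlane a) < gridDist α x (toPlane b)) :
    segment ℝ x (toPlane a) ⊆ closer α A B := by
  intro y hy
  refine ⟨a, ha, fun b hb => ?_⟩
  have h1 := gridDist_add_of_mem_segment α hy
  have h2 := gridDist_triangle α x y (toPlane b)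
  have h3 := hx b hb
  linarith

theorem segment_adj_subset_closer {A B : Set Pixel} (h : ∀ a ∈ A, a ∉ B)
    (h' : ∀ a ∈ A, ∀ b ∈ B, ¬ PixelAdj α a b) {a a' : Pixel} (ha : a ∈ A) (ha' : a' ∈ A)
    (hadj : PixelAdj α a a') : segment ℝ (toPlane a) (toPlane a') ⊆ closer α A B := by
  intro y hy
  have h1 := gridDist_add_of_mem_segment α hy
  rw [PixelAdj] at hadj
  rw [hadj, gridDist_comm α (toPlane a) y] at h1
  by_cases hlt : gridDist α y (toPlane a) < 1
  · exact mem_closer_of_lt_one h h' ha hlt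
  · exact mem_closer_of_lt_one h h' ha' (by linarith)

/-- Each point is joined to its witness in `A` by a segment that stays closer to `A`, and a path of
adjacent pixels in `A` becomes a polygonal path. -/
theorem isPathConnected_closer {A B : Set Pixel} (h : ∀ a ∈ A, a ∉ B)
    (h' : ∀ a ∈ A, ∀ b ∈ B, ¬ PixelAdj α a b) (hA : A.Nonempty)
    (hconn : ∀ a ∈ A, ∀ a' ∈ A,
      Relation.ReflTransGen (fun a b => a ∈ A ∧ b ∈ A ∧ PixelAdj α a b) a a') :
    IsPathConnected (closer α A B) := by
  obtain ⟨a₀, ha₀⟩ := hA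
  have hmem : ∀ a ∈ A, toPlane a ∈ closer α A B := fun a ha =>
    mem_closer_of_lt_one h h' ha (by rw [gridDist_self]; exact one_pos)
  refine ⟨toPlane a₀, hmem a₀ ha₀, ?_⟩
  rintro y ⟨a, ha, hab⟩
  have h1 : JoinedIn (closer α A B) (toPlane a) y :=
    (JoinedIn.of_segment_subset (segment_subset_closer ha hab)).symm
  refine JoinedIn.trans ?_ h1
  have hpath := hconn a₀ ha₀ a ha
  clear h1 hab ha
  induction hpath with
  | refl => exact JoinedIn.refl (hmem _ ha₀)
  | tail _ hbc ih =>
    exact ih.trans (JoinedIn.of_segment_subset (segment_adj_subset_closer h h' hbc.1 hbc.2.1 hbc.2.2))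

end DigitalImage

/-! ### Equidistant points lie on the polygon -/

namespace DigitalImage

variable {α : Connectivity} {E N : Set Pixel}

theorem exists_corner (x : ℝ) (i z : ℤ) (h : (i : ℝ) ≤ x) (h' : x ≤ i + 1) :
    ∃ c : ℤ, (c = i ∨ c = i + 1) ∧ |x - z| = |x - c| + |(c : ℝ) - z| := by
  by_cases hz : z ≤ i
  · refine ⟨i, Or.inl rfl, ?_⟩
    have : (z : ℝ) ≤ i := by exact_mod_cast hz
    rw [abs_of_nonneg (by linarith), abs_of_nonneg (by linarith), abs_of_nonneg (by linarith)]
    ring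
  · refine ⟨i + 1, Or.inr rfl, ?_⟩
    have : (i : ℝ) + 1 ≤ z := by exact_mod_cast not_le.1 hz
    push_cast
    rw [abs_of_nonpos (by linarith), abs_of_nonpos (by linarith), abs_of_nonpos (by linarith)]
    ring

/-- In the `ℓ¹` metric, some geodesic from a point of a cell to a pixel passes through a corner of
the cell. -/
theorem exists_corner_gridDist {x : ℝ × ℝ} {i j : ℤ} (h1 : (i : ℝ) ≤ x.1) (h1' : x.1 ≤ i + 1)
    (h2 : (j : ℝ) ≤ x.2) (h2' : x.2 ≤ j + 1) (z : Pixel) :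
    ∃ c d : ℤ, (c = i ∨ c = i + 1) ∧ (d = j ∨ d = j + 1) ∧
      gridDist .four x (toPlane z) =
        gridDist .four x (toPlane (c, d)) + gridDist .four (toPlane (c, d)) (toPlane z) := by
  obtain ⟨c, hc, hxc⟩ := exists_corner x.1 i z.1 h1 h1'
  obtain ⟨d, hd, hxd⟩ := exists_corner x.2 j z.2 h2 h2'
  refine ⟨c, d, hc, hd, ?_⟩
  simp only [gridDist, toPlane]
  rw [hxc, hxd]
  ring

theorem abs_sub_lt_abs_sub_add_one {x : ℝ} {i c c' : ℤ} (h : (i : ℝ) < x) (h' : x < i + 1)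
    (hc : c = i ∧ c' = i + 1 ∨ c = i + 1 ∧ c' = i) : |x - c'| < |x - c| + 1 := by
  rcases hc with ⟨hc, hc'⟩ | ⟨hc, hc'⟩
  · rw [hc, hc', abs_of_pos (by linarith : 0 < x - i), Int.cast_add, Int.cast_one,
      abs_of_neg (by linarith)]
    linarith
  · rw [hc, hc', abs_of_pos (by linarith : 0 < x - i), Int.cast_add, Int.cast_one,
      abs_of_neg (by linarith)]
    linarith

theorem opposite_corners {i j c c' d d' : ℤ} (hc : c = i ∨ c = i + 1) (hc' : c' = i ∨ c' = i + 1)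
    (hd : d = j ∨ d = j + 1) (hd' : d' = j ∨ d' = j + 1) (hcc : c ≠ c') (hdd : d ≠ d') :
    (c = i ∧ c' = i + 1 ∧ d = j ∧ d' = j + 1) ∨ (c = i + 1 ∧ c' = i ∧ d = j ∧ d' = j + 1) ∨
      (c = i ∧ c' = i + 1 ∧ d = j + 1 ∧ d' = j) ∨ (c = i + 1 ∧ c' = i ∧ d = j + 1 ∧ d' = j) := by
  rcases hc with hc | hc <;> rcases hc' with hc' | hc' <;> rcases hd with hd | hd <;>
    rcases hd' with hd' | hd' <;> simp [hc, hc', hd, hd'] at hcc hdd ⊢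

/-- If no corner of a cell lies in `B`, and every corner outside `A` has a neighbour among the
corners in `A`, then the interior of the cell is closer to `A` than to `B`. -/
theorem mem_closer_of_cell {A B : Set Pixel} (h : ∀ a ∈ A, a ∉ B)
    (h' : ∀ a ∈ A, ∀ b ∈ B, ¬ PixelAdj .four a b) {x : ℝ × ℝ} {i j : ℤ}
    (h1 : (i : ℝ) < x.1) (h1' : x.1 < i + 1) (h2 : (j : ℝ) < x.2) (h2' : x.2 < j + 1)
    (hB : ∀ c d : ℤ, (c = i ∨ c = i + 1) → (d = j ∨ d = j + 1) → (c, d) ∉ B)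
    (hA : ∀ c c' d d' : ℤ, (c = i ∧ c' = i + 1 ∨ c = i + 1 ∧ c' = i) →
      (d = j ∧ d' = j + 1 ∨ d = j + 1 ∧ d' = j) →
      (c, d) ∈ A ∨ (c', d) ∈ A ∨ (c, d') ∈ A) : x ∈ closer .four A B := by
  have hne : A.Nonempty := by
    rcases hA i (i + 1) j (j + 1) (by simp) (by simp) with h | h | h <;> exact ⟨_, h⟩
  obtain ⟨a, ha, hmin⟩ := exists_nearest .four x hne
  refine ⟨a, ha, fun b hb => ?_⟩
  -- The geodesic from `x` to `b` leaves through a corner that is not in `B`, so it continues for at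
  -- least 1. Moving from that corner to a neighbouring one increases the distance from `x` by less
  -- than 1, as `x` is in the open cell.
  obtain ⟨c, d, hc, hd, hcd⟩ := exists_corner_gridDist h1.le h1'.le h2.le h2'.le b
  rw [hcd]
  have hcb : 1 ≤ gridDist .four (toPlane (c, d)) (toPlane b) :=
    one_le_gridDist fun e => hB c d hc hd (e ▸ hb)
  obtain ⟨c', hc'⟩ : ∃ c', c = i ∧ c' = i + 1 ∨ c = i + 1 ∧ c' = i := by
    rcases hc with rfl | rfl <;> simp
  obtain ⟨d', hd'⟩ : ∃ d', d = j ∧ d' = j + 1 ∨ d = j + 1 ∧ d' = j := by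
    rcases hd with rfl | rfl <;> simp
  have hcc' := abs_sub_lt_abs_sub_add_one h1 h1' hc'
  have hdd' := abs_sub_lt_abs_sub_add_one h2 h2' hd'
  rcases hA c c' d d' hc' hd' with hm | hm | hm
  · have := two_le_gridDist (fun e : (c, d) = b => h _ hm (e ▸ hb)) (h' _ hm b hb)
    linarith [hmin _ hm]
  · have := hmin _ hm
    simp only [gridDist, toPlane] at this hcb ⊢
    linarith
  · have := hmin _ hm
    simp only [gridDist, toPlane] at this hcb ⊢
    linarith

/-- The polygon spanned by a set of pixels: the union of the segments between `β`-adjacent ones. -/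
def polygon (α : Connectivity) (Q : Set Pixel) : Set (ℝ × ℝ) :=
  {x | ∃ u ∈ Q, ∃ v ∈ Q, PixelAdj α.dual u v ∧ x ∈ segment ℝ (toPlane u) (toPlane v)}

theorem extPolygon_eq (α : Connectivity) (T : Set Pixel) :
    extPolygon α T = polygon α (extPerimeter α T) := by
  ext x
  constructor
  · rintro ⟨u, hu, v, hv, huv, hx⟩
    exact ⟨u, hu, v, hv, (extPerimeter_adj_iff hu hv).1 huv, hx⟩
  · rintro ⟨u, hu, v, hv, huv, hx⟩
    exact ⟨u, hu, v, hv, (extPerimeter_adj_iff hu hv).2 huv, hx⟩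

theorem mem_segment_of_eq {a b c d : ℝ} {x : ℝ × ℝ} (t : ℝ) (h0 : 0 ≤ t) (h1 : t ≤ 1)
    (hx : x.1 = a + t * (c - a)) (hy : x.2 = b + t * (d - b)) : x ∈ segment ℝ (a, b) (c, d) := by
  refine ⟨1 - t, t, by linarith, h0, by ring, Prod.ext ?_ ?_⟩
  · simp only [Prod.smul_mk, smul_eq_mul, Prod.mk_add_mk, hx]
    ring
  · simp only [Prod.smul_mk, smul_eq_mul, Prod.mk_add_mk, hy]
    ring

namespace Separation

theorem mem_closer_interior (h : Separation α E N) {x : ℝ × ℝ} {n : Pixel} (hn : n ∈ N)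
    (hx : gridDist α x (toPlane n) < 1) : x ∈ closer α N E :=
  mem_closer_of_lt_one (fun a ha hE => h.disjoint a hE ha) h.not_adj hn hx

theorem mem_closer_exterior (h : Separation α E N) {x : ℝ × ℝ} {e : Pixel} (he : e ∈ E)
    (hx : gridDist α x (toPlane e) < 1) : x ∈ closer α E N :=
  mem_closer_of_lt_one h.disjoint (fun a ha b hb hab => h.not_adj b hb a ha hab.symm) he hx

/-- The equidistant points. -/
def equidistant (α : Connectivity) (E N : Set Pixel) : Set (ℝ × ℝ) :=
  {x | x ∉ closer α N E ∧ x ∉ closer α E N}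

theorem middle_of_lt_one (h : Separation α E N) {x : ℝ × ℝ} (hx : x ∈ equidistant α E N)
    {z : Pixel} (hz : gridDist α x (toPlane z) < 1) : z ∈ middle E N :=
  ⟨fun hE => hx.2 (h.mem_closer_exterior hE hz), fun hN => hx.1 (h.mem_closer_interior hN hz)⟩

/-- A horizontal edge has each of its sides entirely in `N` or entirely in `E`, so no third boundary
point of the cell can lie there. -/
theorem four_cell_corner (h : Separation .four E N) {i j c c' d d' : ℤ}
    (hc : c = i ∧ c' = i + 1 ∨ c = i + 1 ∧ c' = i)
    (hd : d = j ∧ d' = j + 1 ∨ d = j + 1 ∧ d' = j) (h0 : (c, d) ∈ middle E N)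
    (h1 : (c', d) ∈ middle E N) (h2 : (c, d') ∈ middle E N) : False := by
  rcases hc with ⟨rfl, rfl⟩ | ⟨rfl, rfl⟩ <;> rcases hd with ⟨rfl, rfl⟩ | ⟨rfl, rfl⟩
  · rcases h.four_edge h0 h1 with h' | h'
    · exact h2.2 h'.1.1
    · exact h2.1 h'.1.1
  · rcases h.four_edge h0 h1 with h' | h'
    · exact h2.1 (by simpa using h'.2.1)
    · exact h2.2 (by simpa using h'.2.1)
  · rcases h.four_edge h1 h0 with h' | h'
    · exact h2.2 h'.1.2
    · exact h2.1 h'.1.2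
  · rcases h.four_edge h1 h0 with h' | h'
    · exact h2.1 (by simpa using h'.2.2)
    · exact h2.2 (by simpa using h'.2.2)

/-- Case `α = 4`: the equidistant points in the interior of a cell lie on a diagonal of the
boundary. -/
theorem four_mem_polygon_of_cell (h : Separation .four E N) {x : ℝ × ℝ}
    (hx : x ∈ equidistant .four E N) {i j : ℤ} (h1 : (i : ℝ) < x.1) (h1' : x.1 < i + 1)
    (h2 : (j : ℝ) < x.2) (h2' : x.2 < j + 1) : x ∈ polygon .four (middle E N) := by
  have hdis : ∀ a ∈ N, a ∉ E := fun a ha hE => h.disjoint a hE ha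
  have hadj : ∀ a ∈ E, ∀ b ∈ N, ¬ PixelAdj .four a b := fun a ha b hb hab =>
    h.not_adj b hb a ha hab.symm
  have hE : ∃ c d : ℤ, (c = i ∨ c = i + 1) ∧ (d = j ∨ d = j + 1) ∧ (c, d) ∈ E := by
    by_contra hcon
    push Not at hcon
    refine hx.1 (mem_closer_of_cell hdis h.not_adj h1 h1' h2 h2' hcon ?_)
    intro c c' d d' hc hd
    by_contra hm
    simp only [not_or] at hm
    exact h.four_cell_corner hc hd ⟨hcon c d (by omega) (by omega), hm.1⟩
      ⟨hcon c' d (by omega) (by omega), hm.2.1⟩ ⟨hcon c d' (by omega) (by omega), hm.2.2⟩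
  have hN : ∃ c d : ℤ, (c = i ∨ c = i + 1) ∧ (d = j ∨ d = j + 1) ∧ (c, d) ∈ N := by
    by_contra hcon
    push Not at hcon
    refine hx.2 (mem_closer_of_cell h.disjoint hadj h1 h1' h2 h2' hcon ?_)
    intro c c' d d' hc hd
    by_contra hm
    simp only [not_or] at hm
    exact h.four_cell_corner hc hd ⟨hm.1, hcon c d (by omega) (by omega)⟩
      ⟨hm.2.1, hcon c' d (by omega) (by omega)⟩ ⟨hm.2.2, hcon c d' (by omega) (by omega)⟩
  obtain ⟨c, d, hc, hd, hcd⟩ := hE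
  obtain ⟨c', d', hc', hd', hcd'⟩ := hN
  have hcc : c ≠ c' := by
    rintro rfl
    by_cases hdd : d = d'
    · exact h.disjoint _ hcd (hdd ▸ hcd')
    · exact h.not_adj _ hcd' _ hcd (pixelAdj_four_iff.2 (Or.inl ⟨rfl, by simp only; omega⟩))
  have hdd : d ≠ d' := by
    rintro rfl
    exact h.not_adj _ hcd' _ hcd (pixelAdj_four_iff.2 (Or.inr ⟨rfl, by simp only; omega⟩))
  have hcc1 : c = c' + 1 ∨ c' = c + 1 := by omega
  have hdd1 : d = d' + 1 ∨ d' = d + 1 := by omega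
  have hm1 : (c, d') ∈ middle E N :=
    ⟨fun hE => h.not_adj _ hcd' _ hE (pixelAdj_four_iff.2 (Or.inr ⟨rfl, hcc1.symm⟩)),
      fun hN => h.not_adj _ hN _ hcd (pixelAdj_four_iff.2 (Or.inl ⟨rfl, hdd1.symm⟩))⟩
  have hm2 : (c', d) ∈ middle E N :=
    ⟨fun hE => h.not_adj _ hcd' _ hE (pixelAdj_four_iff.2 (Or.inl ⟨rfl, hdd1.symm⟩)),
      fun hN => h.not_adj _ hN _ hcd (pixelAdj_four_iff.2 (Or.inr ⟨rfl, hcc1.symm⟩))⟩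
  -- The ℓ¹ distances from `x` to two opposite corners add up to 2. Both are at least 1, so both
  -- equal 1, which places `x` on the other diagonal.
  have hdE : ¬ gridDist .four x (toPlane (c, d)) < 1 := fun hlt =>
    hx.2 (h.mem_closer_exterior hcd hlt)
  have hdN : ¬ gridDist .four x (toPlane (c', d')) < 1 := fun hlt =>
    hx.1 (h.mem_closer_interior hcd' hlt)
  simp only [gridDist, toPlane, not_lt] at hdE hdN
  have hopp := opposite_corners hc hc' hd hd' hcc hdd
  have a1 : |x.1 - i| = x.1 - i := abs_of_pos (by linarith)
  have a2 : |x.1 - (i + 1)| = i + 1 - x.1 := by rw [abs_of_neg (by linarith)]; ring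
  have a3 : |x.2 - j| = x.2 - j := abs_of_pos (by linarith)
  have a4 : |x.2 - (j + 1)| = j + 1 - x.2 := by rw [abs_of_neg (by linarith)]; ring
  have anti : (i + 1, j) ∈ middle E N → (i, j + 1) ∈ middle E N → x.1 - i + (x.2 - j) = 1 →
      x ∈ polygon .four (middle E N) := fun hu hv hxx => by
    refine ⟨_, hu, _, hv, pixelAdj_eight_iff.2 (by simp only; omega), ?_⟩
    refine mem_segment_of_eq (x.2 - j) (by linarith) (by linarith) ?_ ?_
    · push_cast
      linarith
    · push_cast
      ring
  have diag : (i, j) ∈ middle E N → (i + 1, j + 1) ∈ middle E N → x.1 - i = x.2 - j →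
      x ∈ polygon .four (middle E N) := fun hu hv hxx => by
    refine ⟨_, hu, _, hv, pixelAdj_eight_iff.2 (by simp only; omega), ?_⟩
    refine mem_segment_of_eq (x.2 - j) (by linarith) (by linarith) ?_ ?_
    · push_cast
      linarith
    · push_cast
      ring
  clear hc hc' hd hd' hcc hdd hcc1 hdd1
  rcases hopp with ⟨rfl, rfl, rfl, rfl⟩ | ⟨rfl, rfl, rfl, rfl⟩ | ⟨rfl, rfl, rfl, rfl⟩ |
      ⟨rfl, rfl, rfl, rfl⟩ <;> push_cast at hdE hdN <;> simp only [a1, a2, a3, a4] at hdE hdN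
  · exact anti hm2 hm1 (by linarith)
  · exact diag hm2 hm1 (by linarith)
  · exact diag hm1 hm2 (by linarith)
  · exact anti hm1 hm2 (by linarith)

theorem gridDist_of_fst_eq (α : Connectivity) {x y : ℝ × ℝ} (h : x.1 = y.1) :
    gridDist α x y = |x.2 - y.2| := by
  cases α <;> simp [gridDist, h]

theorem gridDist_of_snd_eq (α : Connectivity) {x y : ℝ × ℝ} (h : x.2 = y.2) :
    gridDist α x y = |x.1 - y.1| := by
  cases α <;> simp [gridDist, h]

theorem equidistant_subset_polygon (h : Separation α E N) :
    equidistant α E N ⊆ polygon α (middle E N) := by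
  intro x hx
  have h1 := Int.floor_le x.1
  have h1' := Int.lt_floor_add_one x.1
  have h2 := Int.floor_le x.2
  have h2' := Int.lt_floor_add_one x.2
  set i := ⌊x.1⌋
  set j := ⌊x.2⌋
  rcases h1.eq_or_lt with e1 | l1
  · rcases h2.eq_or_lt with e2 | l2
    · have hxz : x = toPlane (i, j) := Prod.ext e1.symm e2.symm
      have hq : (i, j) ∈ middle E N := h.middle_of_lt_one hx (by
        rw [hxz, gridDist_self]
        exact one_pos)
      -- The polygon consists of edges only, so an isolated boundary pixel would be missed.
      obtain ⟨q', hq', hadj⟩ := h.exists_middle_adj hq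
      exact ⟨_, hq, q', hq', hadj, hxz ▸ left_mem_segment _ _ _⟩
    · have hu : (i, j) ∈ middle E N := h.middle_of_lt_one hx (by
        rw [gridDist_of_fst_eq α (by simp [toPlane, e1]), toPlane, abs_lt]
        constructor <;> simp only <;> linarith)
      have hv : (i, j + 1) ∈ middle E N := h.middle_of_lt_one hx (by
        rw [gridDist_of_fst_eq α (by simp [toPlane, e1]), toPlane, abs_lt]
        constructor <;> push_cast <;> linarith)
      refine ⟨_, hu, _, hv, PixelAdj.of_four (pixelAdj_four_iff.2 (by simp)), ?_⟩
      refine mem_segment_of_eq (x.2 - j) (by linarith) (by linarith) ?_ ?_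
      · rw [← e1]
        ring
      · push_cast
        ring
  · rcases h2.eq_or_lt with e2 | l2
    · have hu : (i, j) ∈ middle E N := h.middle_of_lt_one hx (by
        rw [gridDist_of_snd_eq α (by simp [toPlane, e2]), toPlane, abs_lt]
        constructor <;> simp only <;> linarith)
      have hv : (i + 1, j) ∈ middle E N := h.middle_of_lt_one hx (by
        rw [gridDist_of_snd_eq α (by simp [toPlane, e2]), toPlane, abs_lt]
        constructor <;> push_cast <;> linarith)
      refine ⟨_, hu, _, hv, PixelAdj.of_four (pixelAdj_four_iff.2 (by simp)), ?_⟩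
      refine mem_segment_of_eq (x.1 - i) (by linarith) (by linarith) ?_ ?_
      · push_cast
        ring
      · rw [← e2]
        ring
    · cases α with
      | four => exact h.four_mem_polygon_of_cell hx l1 h1' l2 h2'
      | eight =>
        exfalso
        -- In the ℓ^∞ metric a point of an open cell is at distance less than 1 from all four
        -- corners, which would all be boundary points.
        refine h.eight_cell (x := i) (y := j) ?_ ?_ ?_ ?_ <;> refine h.middle_of_lt_one hx ?_ <;>
          refine max_lt (abs_lt.2 ?_) (abs_lt.2 ?_) <;> constructor <;> simp only [toPlane] <;>
          push_cast <;> linarith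

end Separation

end DigitalImage

/-! ### Points of the polygon are equidistant -/

namespace DigitalImage

variable {α : Connectivity} {E N : Set Pixel}

/-- On a unit edge at parameter `t`, the ℓ¹ distance to pixels other than the end points is at least
`1 + min t (1 - t)`. The bound is sharp at the pixels beside the nearer end point. -/
theorem one_add_min_le_abs (t : ℝ) {i z : ℤ} (hz : z ≠ i)
    (hz' : z ≠ i + 1) : 1 + min t (1 - t) ≤ |i + t - z| := by
  rcases lt_or_gt_of_ne hz with hlt | hgt
  · have : (z : ℝ) + 1 ≤ i := by exact_mod_cast hlt
    exact le_trans (by linarith [min_le_left t (1 - t)]) (le_abs_self _)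
  · have : (i : ℝ) + 2 ≤ z := by
      have : i + 2 ≤ z := by omega
      exact_mod_cast this
    exact le_trans (by linarith [min_le_right t (1 - t)]) (neg_le_abs _)

theorem min_le_abs (t : ℝ) (i z : ℤ) :
    min t (1 - t) ≤ |i + t - z| := by
  by_cases hz : z = i
  · rw [hz]
    exact (min_le_left _ _).trans ((by linarith : t ≤ i + t - i).trans (le_abs_self _))
  by_cases hz' : z = i + 1
  · rw [hz']
    refine (min_le_right _ _).trans (le_trans ?_ (neg_le_abs _))
    push_cast
    linarith
  · linarith [one_add_min_le_abs t hz hz']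

theorem one_le_abs_int_sub {j z : ℤ} (h : z ≠ j) : (1 : ℝ) ≤ |(j : ℝ) - z| := by
  exact_mod_cast Int.one_le_abs (sub_ne_zero.2 h.symm)

theorem one_add_min_le_of_edge (t : ℝ) {i j a b : ℤ}
    (hu : ¬ (a = i ∧ b = j)) (hv : ¬ (a = i + 1 ∧ b = j)) :
    1 + min t (1 - t) ≤ |i + t - a| + |(j : ℝ) - b| := by
  by_cases hb : b = j
  · linarith [one_add_min_le_abs t (fun h => hu ⟨h, hb⟩) (fun h => hv ⟨h, hb⟩),
      abs_nonneg ((j : ℝ) - b)]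
  · linarith [one_le_abs_int_sub hb, min_le_abs t i a]

theorem one_le_max_of_edge {t : ℝ} (h0 : 0 ≤ t) (h1 : t ≤ 1) {i j a b : ℤ}
    (hu : ¬ (a = i ∧ b = j)) (hv : ¬ (a = i + 1 ∧ b = j)) :
    1 ≤ max |i + t - a| |(j : ℝ) - b| := by
  by_cases hb : b = j
  · have := one_add_min_le_abs t (fun h => hu ⟨h, hb⟩) (fun h => hv ⟨h, hb⟩)
    exact le_max_of_le_left (by linarith [le_min h0 (by linarith : 0 ≤ 1 - t)])
  · exact le_max_of_le_right (one_le_abs_int_sub hb)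

theorem abs_le_one_of_edge {t : ℝ} (h0 : 0 ≤ t) (h1 : t ≤ 1) {i a : ℤ}
    (ha : a = i ∨ a = i + 1) : |i + t - a| ≤ 1 := by
  rcases ha with rfl | rfl <;> push_cast <;> rw [abs_le] <;> constructor <;> linarith

theorem one_le_of_diag {t : ℝ} (h0 : 0 ≤ t) (h1 : t ≤ 1) {i j a b : ℤ}
    (hu : ¬ (a = i ∧ b = j)) (hv : ¬ (a = i + 1 ∧ b = j + 1)) :
    1 ≤ |i + t - a| + |j + t - b| := by
  have hnn := le_min h0 (by linarith : 0 ≤ 1 - t)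
  by_cases ha : a = i
  · have hb : b ≠ j := fun h => hu ⟨ha, h⟩
    rw [ha, show (i : ℝ) + t - i = t by ring, abs_of_nonneg h0]
    rcases lt_or_gt_of_ne hb with hlt | hgt
    · have : (b : ℝ) + 1 ≤ j := by exact_mod_cast hlt
      linarith [le_abs_self (j + t - b)]
    · have : (j : ℝ) + 1 ≤ b := by exact_mod_cast hgt
      linarith [neg_le_abs (j + t - b)]
  by_cases ha' : a = i + 1
  · have hb : b ≠ j + 1 := fun h => hv ⟨ha', h⟩
    rw [ha', Int.cast_add, Int.cast_one, show (i : ℝ) + t - (i + 1) = -(1 - t) by ring, abs_neg,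
      abs_of_nonneg (by linarith : 0 ≤ 1 - t)]
    rcases lt_or_gt_of_ne hb with hlt | hgt
    · have : (b : ℝ) ≤ j := by
        have : b ≤ j := by omega
        exact_mod_cast this
      linarith [le_abs_self (j + t - b)]
    · have : (j : ℝ) + 2 ≤ b := by
        have : j + 2 ≤ b := by omega
        exact_mod_cast this
      linarith [neg_le_abs (j + t - b)]
  · linarith [one_add_min_le_abs t ha ha', abs_nonneg (j + t - b)]

theorem one_le_of_antidiag {t : ℝ} (h0 : 0 ≤ t) (h1 : t ≤ 1) {i j a b : ℤ}
    (hu : ¬ (a = i + 1 ∧ b = j)) (hv : ¬ (a = i ∧ b = j + 1)) :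
    1 ≤ |i + 1 - t - a| + |j + t - b| := by
  have := one_le_of_diag h0 h1 (i := -(i + 1)) (j := j) (a := -a) (b := b)
    (fun h => hu ⟨by linarith [h.1], h.2⟩) (fun h => hv ⟨by linarith [h.1], h.2⟩)
  refine this.trans_eq ?_
  congr 1
  rw [← abs_neg]
  push_cast
  ring_nf

namespace Separation

/-- No pixel of `E` or `N` is closer than `m`, since `u` and `v` belong to neither; with both sets
reaching `m`, the distances coincide. -/
theorem equidistant_of_le {m : ℝ} {x : ℝ × ℝ} {u v : Pixel} (hu : u ∈ middle E N)
    (hv : v ∈ middle E N) (hlow : ∀ z, z ≠ u → z ≠ v → m ≤ gridDist α x (toPlane z))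
    (hn : ∃ n ∈ N, gridDist α x (toPlane n) ≤ m) (he : ∃ e ∈ E, gridDist α x (toPlane e) ≤ m) :
    x ∈ equidistant α E N := by
  obtain ⟨n, hn, hnm⟩ := hn
  obtain ⟨e, he, hem⟩ := he
  refine ⟨fun ⟨a, ha, hab⟩ => ?_, fun ⟨a, ha, hab⟩ => ?_⟩
  · have h1 := hlow a (fun h => hu.2 (h ▸ ha)) (fun h => hv.2 (h ▸ ha))
    linarith [hab e he]
  · have h1 := hlow a (fun h => hu.1 (h ▸ ha)) (fun h => hv.1 (h ▸ ha))
    linarith [hab n hn]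

theorem eight_equidistant_of_edge (h : Separation .eight E N) {i j : ℤ} {t : ℝ} (h0 : 0 ≤ t)
    (h1 : t ≤ 1) (hu : (i, j) ∈ middle E N) (hv : (i + 1, j) ∈ middle E N) :
    ((i : ℝ) + t, (j : ℝ)) ∈ equidistant .eight E N := by
  have hnear : ∀ a b : ℤ, (a = i ∨ a = i + 1) → (b = j + 1 ∨ b = j - 1) →
      gridDist .eight ((i : ℝ) + t, (j : ℝ)) (toPlane (a, b)) ≤ 1 := fun a b ha hb => by
    refine max_le (abs_le_one_of_edge h0 h1 ha) ?_
    rcases hb with rfl | rfl <;> simp [toPlane]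
  refine equidistant_of_le (m := 1) hu hv (fun z hz hz' => ?_) ?_ ?_
  · exact one_le_max_of_edge h0 h1 (fun e => hz (Prod.ext e.1 e.2)) (fun e => hz' (Prod.ext e.1 e.2))
  · rcases h.eight_edge hu hv with ⟨-, hn | hn⟩ | ⟨hn | hn, -⟩ <;>
      exact ⟨_, hn, hnear _ _ (by simp) (by simp)⟩
  · rcases h.eight_edge hu hv with ⟨hn | hn, -⟩ | ⟨-, hn | hn⟩ <;>
      exact ⟨_, hn, hnear _ _ (by simp) (by simp)⟩

theorem four_equidistant_of_edge (h : Separation .four E N) {i j : ℤ} {t : ℝ} (h0 : 0 ≤ t)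
    (h1 : t ≤ 1) (hu : (i, j) ∈ middle E N) (hv : (i + 1, j) ∈ middle E N) :
    ((i : ℝ) + t, (j : ℝ)) ∈ equidistant .four E N := by
  have hnear : ∀ (S : Set Pixel) (b : ℤ), (b = j + 1 ∨ b = j - 1) → (i, b) ∈ S → (i + 1, b) ∈ S →
      ∃ z ∈ S, gridDist .four ((i : ℝ) + t, (j : ℝ)) (toPlane z) ≤ 1 + min t (1 - t) := by
    intro S b hb hS hS'
    have hb' : |(j : ℝ) - b| = 1 := by
      rcases hb with rfl | rfl <;> simp
    rcases min_cases t (1 - t) with ⟨hm, -⟩ | ⟨hm, -⟩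
    · refine ⟨_, hS, ?_⟩
      simp only [gridDist, toPlane]
      rw [hm, hb', show (i : ℝ) + t - i = t by ring, abs_of_nonneg h0, add_comm]
    · refine ⟨_, hS', ?_⟩
      simp only [gridDist, toPlane]
      rw [hm, hb', Int.cast_add, Int.cast_one, show (i : ℝ) + t - (i + 1) = -(1 - t) by ring,
        abs_neg, abs_of_nonneg (by linarith : 0 ≤ 1 - t), add_comm]
  refine equidistant_of_le (m := 1 + min t (1 - t)) hu hv (fun z hz hz' => ?_) ?_ ?_
  · exact one_add_min_le_of_edge t (fun e => hz (Prod.ext e.1 e.2))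
      (fun e => hz' (Prod.ext e.1 e.2))
  · rcases h.four_edge hu hv with ⟨hn, -⟩ | ⟨-, hn⟩ <;>
      exact hnear N _ (by simp) hn.1 hn.2
  · rcases h.four_edge hu hv with ⟨-, hn⟩ | ⟨hn, -⟩ <;>
      exact hnear E _ (by simp) hn.1 hn.2

theorem equidistant_of_edge (h : Separation α E N) {i j : ℤ} {t : ℝ} (h0 : 0 ≤ t)
    (h1 : t ≤ 1) (hu : (i, j) ∈ middle E N) (hv : (i + 1, j) ∈ middle E N) :
    ((i : ℝ) + t, (j : ℝ)) ∈ equidistant α E N := by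
  cases α
  · exact h.four_equidistant_of_edge h0 h1 hu hv
  · exact h.eight_equidistant_of_edge h0 h1 hu hv

theorem gridDist_swap (α : Connectivity) (x : ℝ × ℝ) (z : Pixel) :
    gridDist α x.swap (toPlane z.swap) = gridDist α x (toPlane z) := by
  cases α
  · exact add_comm _ _
  · exact max_comm _ _

theorem swap_mem_closer {A B : Set Pixel} {x : ℝ × ℝ} (hx : x ∈ closer α A B) :
    x.swap ∈ closer α (Prod.swap ⁻¹' A) (Prod.swap ⁻¹' B) := by
  obtain ⟨a, ha, hab⟩ := hx
  refine ⟨a.swap, by simpa using ha, fun b hb => ?_⟩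
  have := hab b.swap hb
  rwa [← gridDist_swap α x, ← gridDist_swap α x, Prod.swap_swap] at this

theorem equidistant_of_edge_vertical (h : Separation α E N) {i j : ℤ} {t : ℝ} (h0 : 0 ≤ t)
    (h1 : t ≤ 1) (hu : (i, j) ∈ middle E N) (hv : (i, j + 1) ∈ middle E N) :
    ((i : ℝ), (j : ℝ) + t) ∈ equidistant α E N := by
  have := h.swap.equidistant_of_edge (i := j) (j := i) h0 h1 hu hv
  exact ⟨fun hx => this.1 (swap_mem_closer hx), fun hx => this.2 (swap_mem_closer hx)⟩

theorem four_equidistant_of_diag (h : Separation .four E N) {i j : ℤ} {t : ℝ} (h0 : 0 ≤ t)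
    (h1 : t ≤ 1) (hu : (i, j) ∈ middle E N) (hv : (i + 1, j + 1) ∈ middle E N) :
    ((i : ℝ) + t, (j : ℝ) + t) ∈ equidistant .four E N := by
  have d1 : gridDist .four ((i : ℝ) + t, (j : ℝ) + t) (toPlane (i, j + 1)) ≤ 1 := by
    simp only [gridDist, toPlane]
    rw [Int.cast_add, Int.cast_one, abs_of_nonneg (by linarith), abs_of_nonpos (by linarith)]
    linarith
  have d2 : gridDist .four ((i : ℝ) + t, (j : ℝ) + t) (toPlane (i + 1, j)) ≤ 1 := by
    simp only [gridDist, toPlane]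
    rw [Int.cast_add, Int.cast_one, abs_of_nonpos (by linarith), abs_of_nonneg (by linarith)]
    linarith
  have hlow : ∀ z : Pixel, z ≠ (i, j) → z ≠ (i + 1, j + 1) →
      1 ≤ gridDist .four ((i : ℝ) + t, (j : ℝ) + t) (toPlane z) := fun z hz hz' =>
    one_le_of_diag h0 h1 (fun e => hz (Prod.ext e.1 e.2)) (fun e => hz' (Prod.ext e.1 e.2))
  rcases h.four_diag hu hv with ⟨he, hn⟩ | ⟨hn, he⟩
  · exact equidistant_of_le hu hv hlow ⟨_, hn, d2⟩ ⟨_, he, d1⟩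
  · exact equidistant_of_le hu hv hlow ⟨_, hn, d1⟩ ⟨_, he, d2⟩

theorem four_equidistant_of_antidiag (h : Separation .four E N) {i j : ℤ} {t : ℝ} (h0 : 0 ≤ t)
    (h1 : t ≤ 1) (hu : (i + 1, j) ∈ middle E N) (hv : (i, j + 1) ∈ middle E N) :
    ((i : ℝ) + 1 - t, (j : ℝ) + t) ∈ equidistant .four E N := by
  have d1 : gridDist .four ((i : ℝ) + 1 - t, (j : ℝ) + t) (toPlane (i + 1, j + 1)) ≤ 1 := by
    simp only [gridDist, toPlane]
    rw [Int.cast_add, Int.cast_add, Int.cast_one, abs_of_nonpos (by linarith),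
      abs_of_nonpos (by linarith)]
    linarith
  have d2 : gridDist .four ((i : ℝ) + 1 - t, (j : ℝ) + t) (toPlane (i, j)) ≤ 1 := by
    simp only [gridDist, toPlane]
    rw [abs_of_nonneg (by linarith), abs_of_nonneg (by linarith)]
    linarith
  have hlow : ∀ z : Pixel, z ≠ (i + 1, j) → z ≠ (i, j + 1) →
      1 ≤ gridDist .four ((i : ℝ) + 1 - t, (j : ℝ) + t) (toPlane z) := fun z hz hz' =>
    one_le_of_antidiag h0 h1 (fun e => hz (Prod.ext e.1 e.2)) (fun e => hz' (Prod.ext e.1 e.2))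
  rcases h.four_antidiag hu hv with ⟨he, hn⟩ | ⟨hn, he⟩
  · exact equidistant_of_le hu hv hlow ⟨_, hn, d2⟩ ⟨_, he, d1⟩
  · exact equidistant_of_le hu hv hlow ⟨_, hn, d1⟩ ⟨_, he, d2⟩

theorem polygon_subset_equidistant (h : Separation α E N) :
    polygon α (middle E N) ⊆ equidistant α E N := by
  have key : ∀ u ∈ middle E N, ∀ v ∈ middle E N, PixelAdj α.dual u v →
      (u.2 < v.2 ∨ u.2 = v.2 ∧ u.1 < v.1) →
      segment ℝ (toPlane u) (toPlane v) ⊆ equidistant α E N := by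
    rintro ⟨i, j⟩ hu ⟨k, l⟩ hv hadj hlt x ⟨s, t, hs, ht, hst, rfl⟩
    obtain rfl : s = 1 - t := by linarith
    have ht1 : t ≤ 1 := by linarith
    simp only at hlt
    have hcase : (l = j ∧ k = i + 1) ∨ (l = j + 1 ∧ k = i) ∨
        (α = .four ∧ l = j + 1 ∧ (k = i + 1 ∨ i = k + 1)) := by
      cases α with
      | four =>
        have := pixelAdj_eight_iff.1 hadj
        simp only [true_and] at this ⊢
        omega
      | eight =>
        have := pixelAdj_four_iff.1 hadj
        simp only at this
        omega
    rcases hcase with ⟨rfl, rfl⟩ | ⟨rfl, rfl⟩ | ⟨rfl, rfl, rfl | rfl⟩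
    · convert h.equidistant_of_edge ht ht1 hu hv using 1
      refine Prod.ext ?_ ?_ <;> simp [toPlane] <;> ring
    · convert h.equidistant_of_edge_vertical ht ht1 hu hv using 1
      refine Prod.ext ?_ ?_ <;> simp [toPlane] <;> ring
    · convert h.four_equidistant_of_diag ht ht1 hu hv using 1
      refine Prod.ext ?_ ?_ <;> simp [toPlane] <;> ring
    · convert h.four_equidistant_of_antidiag ht ht1 hu hv using 1
      refine Prod.ext ?_ ?_ <;> simp [toPlane] <;> ring
  rintro x ⟨u, hu, v, hv, hadj, hx⟩
  have hne := hadj.ne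
  rw [ne_eq, Prod.ext_iff] at hne
  have : (u.2 < v.2 ∨ u.2 = v.2 ∧ u.1 < v.1) ∨ (v.2 < u.2 ∨ v.2 = u.2 ∧ v.1 < u.1) := by omega
  -- Reversing the edge if necessary, only right, up and the two upward diagonal directions remain.
  rcases this with hlt | hlt
  · exact key u hu v hv hadj hlt hx
  · rw [segment_symm] at hx
    exact key v hv u hu hadj.symm hlt hx

theorem polygon_eq_equidistant (h : Separation α E N) :
    polygon α (middle E N) = equidistant α E N :=
  h.polygon_subset_equidistant.antisymm h.equidistant_subset_polygon

/-! ### Identification of the region and the conclusion -/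

theorem isBounded_closer (h : Separation α E N) (hE : Eᶜ.Finite) :
    Bornology.IsBounded (closer α N E) := by
  refine ((Bornology.isBounded_biUnion hE).2 fun k _ =>
    Metric.isBounded_closedBall (x := toPlane k) (r := 1)).subset ?_
  rintro x ⟨n, hn, hne⟩
  -- Rounding gives a pixel at distance at most 1. If it is exterior, the witness `n` is closer
  -- still. So the set is covered by unit balls around the finitely many pixels outside `E`.
  have hz : ∃ z ∉ E, gridDist α x (toPlane z) ≤ 1 := by
    have h1 : gridDist α x (toPlane (round x.1, round x.2)) ≤ 1 := by
      refine (gridDist_le_add _ _ _).trans ?_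
      have := abs_sub_round x.1
      have := abs_sub_round x.2
      simp only [toPlane]
      linarith
    by_cases hz : (round x.1, round x.2) ∈ E
    · exact ⟨n, fun hE => h.disjoint n hE hn, (hne _ hz).le.trans h1⟩
    · exact ⟨_, hz, h1⟩
  obtain ⟨z, hz, hxz⟩ := hz
  refine Set.mem_biUnion hz (Metric.mem_closedBall.2 ?_)
  rw [Prod.dist_eq, Real.dist_eq, Real.dist_eq]
  exact max_le ((abs_fst_le_gridDist α x (toPlane z)).trans hxz)
    ((abs_snd_le_gridDist α x (toPlane z)).trans hxz)

theorem not_isBounded_closer (h : Separation α E N) (hE : E.Infinite) :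
    ¬ Bornology.IsBounded (closer α E N) := by
  intro hb
  obtain ⟨R, hR⟩ := hb.subset_closedBall 0
  refine hE ((Set.finite_Icc ((⌊-R⌋, ⌊-R⌋) : Pixel) (⌈R⌉, ⌈R⌉)).subset fun z hz => ?_)
  have h1 := hR (h.mem_closer_exterior hz (by rw [gridDist_self]; exact one_pos))
  rw [Metric.mem_closedBall, dist_zero_right, Prod.norm_def, max_le_iff, Real.norm_eq_abs,
    Real.norm_eq_abs, abs_le, abs_le] at h1
  simp only [toPlane] at h1
  obtain ⟨⟨h1, h2⟩, h3, h4⟩ := h1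
  refine ⟨⟨?_, ?_⟩, ⟨?_, ?_⟩⟩
  · exact_mod_cast (Int.floor_le _).trans h1
  · exact_mod_cast (Int.floor_le _).trans h3
  · exact_mod_cast h2.trans (Int.le_ceil _)
  · exact_mod_cast h4.trans (Int.le_ceil _)

/-- A point closer to `E` has the whole unbounded connected set `closer α E N` in its component. A
component that meets `closer α N E` cannot leave it, because the complement of the polygon is split
by two disjoint open sets. -/
theorem region_eq_closer (h : Separation α E N) (hE : E.Infinite) (hEc : Eᶜ.Finite)
    (hN : N.Nonempty) :
    {x | x ∉ polygon α (middle E N) ∧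
      Bornology.IsBounded (connectedComponentIn (polygon α (middle E N))ᶜ x)} = closer α N E := by
  rw [h.polygon_eq_equidistant]
  have hcompl : (equidistant α E N)ᶜ = closer α N E ∪ closer α E N := by
    ext x
    simp only [equidistant, Set.mem_compl_iff, Set.mem_ofPred_eq, Set.mem_union]
    tauto
  have hdisj := disjoint_closer α N E
  ext x
  constructor
  · rintro ⟨hx, hb⟩
    rw [← Set.mem_compl_iff, hcompl] at hx
    refine hx.resolve_right fun hxE => h.not_isBounded_closer hE (hb.subset ?_)
    have hconn : IsPathConnected (closer α E N) := isPathConnected_closer h.disjoint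
      (fun a ha b hb hab => h.not_adj b hb a ha hab.symm) hE.nonempty h.connected
    exact hconn.isConnected.isPreconnected.subset_connectedComponentIn hxE
      (hcompl ▸ Set.subset_union_right)
  · intro hx
    have hx' : x ∈ (equidistant α E N)ᶜ := hcompl ▸ Or.inl hx
    refine ⟨hx', (h.isBounded_closer hEc).subset ?_⟩
    refine isPreconnected_connectedComponentIn.subset_left_of_subset_union
      (isOpen_closer α N hE.nonempty) (isOpen_closer α E hN) hdisj ?_
      ⟨x, mem_connectedComponentIn hx', hx⟩
    rw [← hcompl]
    exact connectedComponentIn_subset _ _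

/-- A boundary pixel has an exterior neighbour at distance exactly 1, and no pixel of `N` is nearer
than that. -/
theorem toPlane_mem_closer_iff (h : Separation α E N) {z : Pixel} :
    toPlane z ∈ closer α N E ↔ z ∈ N := by
  constructor
  · rintro ⟨n, hn, hne⟩
    by_contra hz
    by_cases hzE : z ∈ E
    · have := hne z hzE
      rw [gridDist_self] at this
      exact this.not_ge (gridDist_nonneg _ _ _)
    · obtain ⟨e, he, hze⟩ := h.exists_exterior z ⟨hzE, hz⟩
      have h1 := hne e he
      rw [hze] at h1
      exact h1.not_ge (one_le_gridDist fun e => hz (e ▸ hn))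
  · exact fun hz => h.mem_closer_interior hz (by rw [gridDist_self]; exact one_pos)

end Separation

end DigitalImage

theorem lemma6p1 (α : DigitalImage.Connectivity) (T : Set DigitalImage.Pixel)
    (hT : DigitalImage.IsComponent α T) :
    DigitalImage.region α T =
      {x : ℝ × ℝ | DigitalImage.distTo α x (DigitalImage.interiorPixels α T) <
        DigitalImage.distTo α x (DigitalImage.exterior α T)} := by
  have h := DigitalImage.separation hT
  obtain ⟨t⟩ := hT.2.nonempty
  have hregion : DigitalImage.region α T =
      DigitalImage.closer α (DigitalImage.inner α T) (DigitalImage.exterior α T) := by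
    rw [← h.region_eq_closer (DigitalImage.exterior_infinite hT.1)
      (DigitalImage.exterior_compl_finite hT.1) ⟨t, DigitalImage.subset_inner hT.1 t.2⟩,
      DigitalImage.middle_inner hT.1, ← DigitalImage.extPolygon_eq]
    rfl
  have hinterior : DigitalImage.interiorPixels α T = DigitalImage.inner α T := by
    ext z
    rw [← h.toPlane_mem_closer_iff, ← hregion]
    rfl
  rw [hinterior, hregion]
  ext x
  exact DigitalImage.distTo_lt_distTo_iff.symm
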